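/- **Setting.** Let $2\le k<n$, let $M=(\mu_{i,j})\in\mathbb R^{n\times k}$ have nonnegative entries, rows $m_1,\dots,m_n$ and columns $\mu_1,\dots,\mu_k$, and let $\Omega=(\omega_1,\dots,\omega_k)$ have nonnegative entries (in the single topic model the columns of $M$ and $\Omega$ are probability vectors). Put $M_2=M\,\mathrm{diag}(\Omega)M'=\sum_j\omega_j\,\mu_j\otimes\mu_j$ and $M_3=\sum_j\omega_j\,\mu_j\otimes\mu_j\otimes\mu_j$. For a matrix $E$ with $n$ rows let $E_i$ be $E$ with row $i$ removed (likewise $\tilde E_i$); let $M_{2,i}$ be $M_2$ with row and column $i$ removed and $M_{3,i}=\big((M_3)_{l,h,i}\big)_{l,h\ne i}$ (likewise $\tilde M_{3,i}$). For $A$ of full column rank, $A^\star=(A'A)^{-1}A'$. Assume that $M_{2,i}$ has rank $k$ for every $i$ and that $$\alpha_{M_2}=\min_{i\le k}\big(\sigma_i(M_2)^2-\sigma_{i+1}(M_2)^2\big)>0,$$ where $\sigma_1\ge\sigma_2\ge\dots$ are the singular values. For a feature $r$ put $\alpha_r=\min_{i\ne j}|\mu_{r,i}-\mu_{r,j}|$.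 Let $E\in\mathbb R^{n\times k}$ be any matrix with $EE'=M_2$ and $O$ any matrix of left singular vectors (singular values in decreasing order) of $E_r^\star M_{3,r}(E_r^\star)'$. **Algorithm (with perturbed data $\tilde M_2\in\mathbb R^{n\times n}$, $\tilde M_3\in\mathbb R^{n\times n\times n}$, rank $k$, feature $r$).** Take an SVD $\tilde M_2=\tilde U\tilde S\tilde V'$; put $\tilde E=\tilde U_k\tilde S_k^{1/2}$ (first $k$ left singular vectors and singular values) and $\tilde H_i=\tilde E_i^\star\tilde M_{3,i}(\tilde E_i^\star)'$; let $\tilde O$ and $\tilde m_r$ be the left singular vectors and the singular values (in decreasing order) of $\tilde H_r$; for $i\ne r$ let $\tilde m_i$ be the diagonal of $\tilde O'\tilde H_i\tilde O$. Return the matrix $\tilde M$ with rows $\tilde m_1,\dots,\tilde m_n$. **Theorem.** There are universal polynomials $C_1,C_2,C_3$ in $\|E_i\|_F,\|E_i^\star\|_F,\|O\|_F,\|M_{3,i}\|_F$ and $C_4$ in these quantities and $\frac1{\alpha_r},\frac1{\alpha_{M_2}}$ such that the following holds for all $n,k,M,\Omega$ as above. There is $\gamma=\gamma(M,\Omega)>0$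 such that, for every feature $r$ with $\alpha_r>0$, after the columns of $M$ are ordered so that $\mu_{r,1}>\dots>\mu_{r,k}$: whenever $\epsilon<\gamma$ and $$\|\tilde M_2-M_2\|_F<\epsilon,\qquad \|\tilde M_3-M_3\|_F<\epsilon,$$ every run of the algorithm (that is, for every choice of the two SVDs) has $\tilde E_i$ of full column rank for all $i$ and returns a matrix whose rows satisfy, for all $i\in\{1,\dots,n\}$, $$\|m_i-\tilde m_i\|_2\le C_1\epsilon+\sqrt k\,\frac{\epsilon}{\alpha_r}\Big(C_2+\frac{C_3}{\alpha_{M_2}}\Big)+\sqrt k\,C_4\,\epsilon^2 .$$ -/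

import Mathlib

-- `‖A‖` is the Frobenius norm for every real matrix `A`.
open scoped Matrix Matrix.Norms.Frobenius

noncomputable section

namespace SVTD

/-- The index set `{1, …, n}` with `i` removed. -/
abbrev Without {n : ℕ} (i : Fin n) : Type := {l : Fin n // l ≠ i}

/-- `M₂ = M diag(Ω) Mᵀ`. -/
def secondMoment {ι : Type*} {k : ℕ} (M : Matrix ι (Fin k) ℝ) (ω : Fin k → ℝ) :
    Matrix ι ι ℝ :=
  M * Matrix.diagonal ω * Mᵀ

/-- `M₃ = ∑ⱼ ωⱼ μⱼ ⊗ μⱼ ⊗ μⱼ`, where `μⱼ` are the columns of `M`. -/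
def thirdMoment {n k : ℕ} (M : Matrix (Fin n) (Fin k) ℝ) (ω : Fin k → ℝ) :
    Fin n → Fin n → Fin n → ℝ :=
  fun h l m => ∑ j, ω j * M h j * M l j * M m j

/-- The Frobenius norm of a tensor of order three. -/
def tensorNorm {n : ℕ} (T : Fin n → Fin n → Fin n → ℝ) : ℝ :=
  √(∑ h, ∑ l, ∑ m, T h l m ^ 2)

/-- The matrix `E` with row `i` removed. -/
def removeRow {n k : ℕ} (E : Matrix (Fin n) (Fin k) ℝ) (i : Fin n) :
    Matrix (Without i) (Fin k) ℝ :=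
  Matrix.of fun l j => E l j

/-- The `i`-th slice of a tensor of order three, after the removal of feature `i`. -/
def slice {n : ℕ} (T : Fin n → Fin n → Fin n → ℝ) (i : Fin n) :
    Matrix (Without i) (Without i) ℝ :=
  Matrix.of fun l h => T l h i

/-- `E⋆ = (Eᵀ E)⁻¹ Eᵀ`, the Moore–Penrose pseudoinverse of a matrix of full column rank. -/
def pinv {ι : Type*} [Fintype ι] {k : ℕ} (E : Matrix ι (Fin k) ℝ) : Matrix (Fin k) ι ℝ :=
  (Eᵀ * E)⁻¹ * Eᵀ

/-- `Hᵢ = Eᵢ⋆ M₃,ᵢ (Eᵢᵀ)⋆`. -/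
def coreSlice {n k : ℕ} (E : Matrix (Fin n) (Fin k) ℝ) (T : Fin n → Fin n → Fin n → ℝ)
    (i : Fin n) : Matrix (Fin k) (Fin k) ℝ :=
  pinv (removeRow E i) * slice T i * (pinv (removeRow E i))ᵀ

/-- `A = U diag(s) Vᵀ` is a singular value decomposition of the square matrix `A`, with the
singular values in decreasing order. -/
structure IsSVD {m : ℕ} (A U : Matrix (Fin m) (Fin m) ℝ) (s : Fin m → ℝ)
    (V : Matrix (Fin m) (Fin m) ℝ) : Prop where
  left_orthogonal : U ∈ Matrix.orthogonalGroup (Fin m) ℝ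
  right_orthogonal : V ∈ Matrix.orthogonalGroup (Fin m) ℝ
  nonneg : ∀ i, 0 ≤ s i
  antitone : Antitone s
  eq : A = U * Matrix.diagonal s * Vᵀ

/-- `α_r`, the minimal gap between two entries of row `r` of `M` (used for `k ≥ 2` only). -/
def rowGap {n k : ℕ} (M : Matrix (Fin n) (Fin k) ℝ) (r : Fin n) : ℝ :=
  ⨅ p : {p : Fin k × Fin k // p.1 ≠ p.2}, |M r p.1.1 - M r p.1.2|

/-- The singular values of a square matrix in decreasing order, numbered from `0` and extended
by zeros. -/
def singularValue {n : ℕ} (A : Matrix (Fin n) (Fin n) ℝ) (i : ℕ) : ℝ :=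
  (Matrix.toEuclideanLin A).singularValues i

/-- `min_{i ≤ k} (σᵢ(A)² - σᵢ₊₁(A)²)` (used for `k ≥ 2` only). -/
def singularGap {n : ℕ} (k : ℕ) (A : Matrix (Fin n) (Fin n) ℝ) : ℝ :=
  ⨅ i : Fin k, (singularValue A i ^ 2 - singularValue A (i + 1) ^ 2)

/-- A run of the perturbed SVTD algorithm with rank `k` and selected feature `r` on the matrix
`M2` and the tensor `M3`. The only choices in a run are those of the two singular value
decompositions. The estimate of `Ω` that the algorithm computes last, from the estimate of `M`
and from the first moment, has no influence on the estimate of `M` and is left out. -/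
structure Run {n k : ℕ} (hkn : k < n) (r : Fin n) (M2 : Matrix (Fin n) (Fin n) ℝ)
    (M3 : Fin n → Fin n → Fin n → ℝ) where
  U : Matrix (Fin n) (Fin n) ℝ
  S : Fin n → ℝ
  V : Matrix (Fin n) (Fin n) ℝ
  svd : IsSVD M2 U S V
  /-- `E = U_k S_k^{1/2}`, from the first `k` left singular vectors and singular values -/
  E : Matrix (Fin n) (Fin k) ℝ
  E_eq : E = Matrix.of fun l j => U l (Fin.castLE hkn.le j) * √(S (Fin.castLE hkn.le j))
  /-- the left singular vectors of `H_r` -/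
  O : Matrix (Fin k) (Fin k) ℝ
  /-- the singular values of `H_r` -/
  s : Fin k → ℝ
  W : Matrix (Fin k) (Fin k) ℝ
  svd_r : IsSVD (coreSlice E M3 r) O s W

/-- The estimate of `M` returned by a run: row `r` consists of the singular values of `H_r`, any
other row `i` of the diagonal entries of `Oᵀ Hᵢ O`. -/
def Run.output {n k : ℕ} {hkn : k < n} {r : Fin n} {M2 : Matrix (Fin n) (Fin n) ℝ}
    {M3 : Fin n → Fin n → Fin n → ℝ} (R : Run hkn r M2 M3) : Matrix (Fin n) (Fin k) ℝ :=
  Matrix.of fun i j => if i = r then R.s j else (R.Oᵀ * coreSlice R.E M3 i * R.O) j j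

end SVTD

end

/-!
Write `E₀ = M diag(Ω)^{1/2}`. This is a factor of `M₂`, and the slices satisfy
`M₃,ᵢ = (E₀)ᵢ diag(mᵢ) (E₀)ᵢᵀ`, so the core slices formed with `E₀` are exactly `diag(mᵢ)`. Any other
factor of `M₂` is `E₀ Q` with `Q` orthogonal; hence the norms in the bound are those of `E₀`, and the
algorithm has to be analysed only up to an orthogonal change of coordinates.

*Alignment.* Let `U`, `V` be the first `k` left and right singular vectors of the perturbed matrix
and `S` its first `k` singular values. Up to `O(ε)` one has `U S = M₂ V` and `V S = M₂ U`, so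
`(U - V) S + M₂ (U - V) = O(ε)`. As `M₂ ≥ 0` and `S ≥ 0`, the two summands have a nonnegative inner
product, which gives `M₂ (U - V) = O(ε)` and `M₂ U - U S = O(ε)`, with absolute constants
(`norm_mul_leading_sub_le`). Then `Q = E₀ᵀ U S^{-1/2}` is nearly orthogonal, `U S^{1/2}` is close to
`E₀ Q`, and the polar decomposition of `Q` gives the change of coordinates (`exists_alignment`). The
singular values in `S` are at least about `‖Eᵢ⋆‖⁻²` for each `i`, which bounds the error of the
factor with row `i` removed by `ε` times a polynomial in `‖Eᵢ‖` and `‖Eᵢ⋆‖`. A perturbation bound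
for the pseudoinverse turns this into
`‖Gᵢ - diag(mᵢ)‖ ≤ p(‖Eᵢ‖, ‖Eᵢ⋆‖, ‖M₃,ᵢ‖) ε` for the aligned core slices `Gᵢ`
(`Run.exists_orthogonal_coreSlice`).

*Singular vectors.* For `i = r` the error is controlled by Weyl's inequality
(`IsSVD.abs_singular_sub_le`). For `i ≠ r`, the left singular vectors `B` of `G_r` have off-diagonal
entries of order `ε` after the columns are put in order (`abs_left_singular_le`), and since
`(Bᵀ diag(mᵢ) B)ⱼⱼ` is a weighted mean of the entries of `mᵢ` with weights `B_{lj}²`, the error of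
the singular vectors contributes only to order `ε²` (`norm_diag_conj_sub_le`).

The constant of this quadratic term depends on `M` and `Ω`, and the threshold `γ(M, Ω)` is chosen so
that the term is at most `ε`. Thus the row error is at most `C₁ ε` for the single polynomial
`errorPoly`: neither the gap `α_r` nor the gap `α_{M₂}` is needed in the first-order term. This bound
is stronger than the stated one, which follows with `C₂ = C₃ = C₄ = 0`.
-/

open scoped Matrix Matrix.Norms.Frobenius

namespace SVTD

/-! ### The Frobenius norm -/

section Frobenius

variable {ι κ p : Type*} [Fintype ι] [Fintype κ] [Fintype p]

lemma norm_sq_eq_sum (A : Matrix ι κ ℝ) : ‖A‖ ^ 2 = ∑ i, ∑ j, A i j ^ 2 := by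
  rw [Matrix.frobenius_norm_def, ← Real.sqrt_eq_rpow]
  have h : ∀ i j, ‖A i j‖ ^ (2 : ℝ) = A i j ^ 2 := fun i j => by simp
  simp only [h]
  exact Real.sq_sqrt (by positivity)

lemma norm_sq_eq_trace (A : Matrix ι κ ℝ) : ‖A‖ ^ 2 = (Aᵀ * A).trace := by
  rw [norm_sq_eq_sum, Finset.sum_comm]
  simp [Matrix.trace, Matrix.mul_apply, sq]

lemma abs_entry_le_norm (A : Matrix ι κ ℝ) (i : ι) (j : κ) : |A i j| ≤ ‖A‖ := by
  refine abs_le_of_sq_le_sq ?_ (norm_nonneg _)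
  rw [norm_sq_eq_sum]
  refine le_trans ?_ (Finset.single_le_sum (f := fun i => ∑ j, A i j ^ 2)
    (fun _ _ => by positivity) (Finset.mem_univ i))
  exact Finset.single_le_sum (f := fun j => A i j ^ 2) (fun _ _ => by positivity)
    (Finset.mem_univ j)

lemma norm_mul_of_transpose_mul [DecidableEq κ] {U : Matrix ι κ ℝ} (hU : Uᵀ * U = 1)
    (A : Matrix κ p ℝ) : ‖U * A‖ = ‖A‖ := by
  rw [← sq_eq_sq₀ (norm_nonneg _) (norm_nonneg _), norm_sq_eq_trace, norm_sq_eq_trace,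
    Matrix.transpose_mul, Matrix.mul_assoc, ← Matrix.mul_assoc Uᵀ, hU, Matrix.one_mul]

lemma norm_mul_of_mul_transpose [DecidableEq ι] {U : Matrix ι κ ℝ} (hU : U * Uᵀ = 1)
    (A : Matrix p ι ℝ) : ‖A * U‖ = ‖A‖ := by
  rw [← Matrix.frobenius_norm_transpose, Matrix.transpose_mul,
    norm_mul_of_transpose_mul (by simpa using hU), Matrix.frobenius_norm_transpose]

lemma norm_mul_le_of_projection [DecidableEq ι] {P : Matrix ι ι ℝ} (hT : Pᵀ = P)
    (hP : P * P = P) (A : Matrix p ι ℝ) : ‖A * P‖ ≤ ‖A‖ := by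
  have key : ‖A‖ ^ 2 = ‖A * P‖ ^ 2 + ‖A * (1 - P)‖ ^ 2 := by
    have aux : ∀ X : Matrix p ι ℝ, ‖X‖ ^ 2 = (X * Xᵀ).trace := fun X => by
      rw [norm_sq_eq_trace, Matrix.trace_mul_comm]
    rw [aux, aux, aux, ← Matrix.trace_add]
    congr 1
    have h1 : A * P * (A * P)ᵀ = A * P * Aᵀ := by
      rw [Matrix.transpose_mul, hT, Matrix.mul_assoc A, ← Matrix.mul_assoc P, hP,
        Matrix.mul_assoc]
    have h2 : A * (1 - P) * (A * (1 - P))ᵀ = A * (1 - P) * Aᵀ := by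
      have : (1 - P) * (1 - P) = 1 - P := by
        rw [Matrix.mul_sub, Matrix.mul_one, Matrix.sub_mul, hP]; simp
      rw [Matrix.transpose_mul, Matrix.transpose_sub, Matrix.transpose_one, hT,
        Matrix.mul_assoc A, ← Matrix.mul_assoc (1 - P), this, Matrix.mul_assoc]
    rw [h1, h2, ← Matrix.add_mul, ← Matrix.mul_add]
    simp
  nlinarith [norm_nonneg A, norm_nonneg (A * P), sq_nonneg ‖A * (1 - P)‖,
    abs_le_of_sq_le_sq' (by nlinarith [sq_nonneg ‖A * (1 - P)‖] : ‖A * P‖ ^ 2 ≤ ‖A‖ ^ 2)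
      (norm_nonneg A)]

lemma norm_mul_le_of_isometry [DecidableEq ι] [DecidableEq κ] {U : Matrix ι κ ℝ}
    (hU : Uᵀ * U = 1) (A : Matrix p ι ℝ) : ‖A * U‖ ≤ ‖A‖ := by
  rw [← norm_mul_of_mul_transpose (U := Uᵀ) (by simpa using hU) (A * U), Matrix.mul_assoc]
  refine norm_mul_le_of_projection (by simp) ?_ A
  rw [Matrix.mul_assoc, ← Matrix.mul_assoc Uᵀ, hU, Matrix.one_mul]

lemma norm_diagonal_mul_le [DecidableEq ι] {s : ι → ℝ} {c : ℝ} {z : Matrix ι κ ℝ}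
    (hc : 0 ≤ c) (h : ∀ i j, z i j = 0 ∨ |s i| ≤ c) : ‖Matrix.diagonal s * z‖ ≤ c * ‖z‖ := by
  refine (abs_le_of_sq_le_sq' ?_ (by positivity)).2
  rw [mul_pow, norm_sq_eq_sum, norm_sq_eq_sum, Finset.mul_sum]
  refine Finset.sum_le_sum fun i _ => ?_
  rw [Finset.mul_sum]
  refine Finset.sum_le_sum fun j _ => ?_
  rw [Matrix.diagonal_mul, mul_pow]
  rcases h i j with h | h
  · simp [h]
  · exact mul_le_mul_of_nonneg_right (sq_le_sq' (by linarith [abs_le.1 h]) (abs_le.1 h).2)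
      (sq_nonneg _)

lemma norm_mul_diagonal_le [DecidableEq ι] {s : ι → ℝ} {c : ℝ} {z : Matrix κ ι ℝ}
    (hc : 0 ≤ c) (h : ∀ i, |s i| ≤ c) : ‖z * Matrix.diagonal s‖ ≤ ‖z‖ * c := by
  rw [← Matrix.frobenius_norm_transpose, Matrix.transpose_mul, Matrix.diagonal_transpose,
    ← Matrix.frobenius_norm_transpose z, mul_comm]
  exact norm_diagonal_mul_le hc fun i _ => Or.inr (h i)

lemma le_norm_diagonal_mul [DecidableEq ι] {s : ι → ℝ} {c : ℝ} {z : Matrix ι κ ℝ}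
    (hc : 0 ≤ c) (h : ∀ i j, z i j = 0 ∨ c ≤ s i) : c * ‖z‖ ≤ ‖Matrix.diagonal s * z‖ := by
  refine (abs_le_of_sq_le_sq' ?_ (by positivity)).2
  rw [mul_pow, norm_sq_eq_sum, norm_sq_eq_sum, Finset.mul_sum]
  refine Finset.sum_le_sum fun i _ => ?_
  rw [Finset.mul_sum]
  refine Finset.sum_le_sum fun j _ => ?_
  rw [Matrix.diagonal_mul, mul_pow]
  rcases h i j with h | h
  · simp [h]
  · exact mul_le_mul_of_nonneg_right (by gcongr) (sq_nonneg _)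

end Frobenius

/-- Fewer than `k` linear conditions on `k` unknowns have a common nontrivial solution: the rows
of `N` other than `j` annihilate some nonzero column vector. -/
lemma exists_ne_zero_mul_eq_zero {k : ℕ} (N : Matrix (Fin k) (Fin k) ℝ) (j : Fin k) :
    ∃ x : Matrix (Fin k) (Fin 1) ℝ, x ≠ 0 ∧ ∀ l, l ≠ j → (N * x) l 0 = 0 := by
  obtain ⟨v, hv, h⟩ := Matrix.exists_mulVec_eq_zero_iff.2
    (Matrix.det_eq_zero_of_row_eq_zero (A := N.updateRow j 0) j (by simp))
  refine ⟨Matrix.of fun l _ => v l, fun h0 => hv ?_, fun l hl => ?_⟩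
  · funext l
    simpa using congrFun (congrFun h0 l) 0
  · have := congrFun h l
    simpa [Matrix.mulVec, dotProduct, Matrix.mul_apply, Matrix.updateRow_ne hl] using this

/-! ### Singular value decompositions -/

namespace IsSVD

variable {m : ℕ} {A U V : Matrix (Fin m) (Fin m) ℝ} {s : Fin m → ℝ}

lemma left_tr_mul (h : IsSVD A U s V) : Uᵀ * U = 1 :=
  (Matrix.mem_orthogonalGroup_iff' _ _).1 h.left_orthogonal

lemma left_mul_tr (h : IsSVD A U s V) : U * Uᵀ = 1 :=
  (Matrix.mem_orthogonalGroup_iff _ _).1 h.left_orthogonal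

lemma right_tr_mul (h : IsSVD A U s V) : Vᵀ * V = 1 :=
  (Matrix.mem_orthogonalGroup_iff' _ _).1 h.right_orthogonal

lemma right_mul_tr (h : IsSVD A U s V) : V * Vᵀ = 1 :=
  (Matrix.mem_orthogonalGroup_iff _ _).1 h.right_orthogonal

lemma norm_mul (h : IsSVD A U s V) {κ : Type*} [Fintype κ] (x : Matrix (Fin m) κ ℝ) :
    ‖A * x‖ = ‖Matrix.diagonal s * (Vᵀ * x)‖ := by
  rw [h.eq, Matrix.mul_assoc, Matrix.mul_assoc, norm_mul_of_transpose_mul h.left_tr_mul]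

lemma norm_right_tr_mul (h : IsSVD A U s V) {κ : Type*} [Fintype κ] (x : Matrix (Fin m) κ ℝ) :
    ‖Vᵀ * x‖ = ‖x‖ :=
  norm_mul_of_transpose_mul (by simpa using h.right_mul_tr) x

lemma norm_mul_le_of_forall_lt (h : IsSVD A U s V) {x : Matrix (Fin m) (Fin 1) ℝ} {j : Fin m}
    (hx : ∀ l, l < j → (Vᵀ * x) l 0 = 0) : ‖A * x‖ ≤ s j * ‖x‖ := by
  rw [h.norm_mul, ← h.norm_right_tr_mul x]
  refine norm_diagonal_mul_le (h.nonneg j) fun l i => ?_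
  rcases lt_or_ge l j with hl | hl
  · exact Or.inl (by rw [Subsingleton.elim i 0]; exact hx l hl)
  · exact Or.inr (by rw [abs_of_nonneg (h.nonneg l)]; exact h.antitone hl)

lemma le_norm_mul_of_forall_gt (h : IsSVD A U s V) {x : Matrix (Fin m) (Fin 1) ℝ} {j : Fin m}
    (hx : ∀ l, j < l → (Vᵀ * x) l 0 = 0) : s j * ‖x‖ ≤ ‖A * x‖ := by
  rw [h.norm_mul, ← h.norm_right_tr_mul x]
  refine le_norm_diagonal_mul (h.nonneg j) fun l i => ?_
  rcases lt_or_ge j l with hl | hl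
  · exact Or.inl (by rw [Subsingleton.elim i 0]; exact hx l hl)
  · exact Or.inr (h.antitone hl)

/-- One half of Weyl's inequality for singular values. Some nonzero vector is orthogonal to the
right singular vectors of `A` before the `j`-th and to those of `A'` after the `j`-th, and on it both
matrices can be compared. -/
lemma singular_le_add {A' U' V' : Matrix (Fin m) (Fin m) ℝ} {s' : Fin m → ℝ}
    (h : IsSVD A U s V) (h' : IsSVD A' U' s' V') (j : Fin m) : s' j ≤ s j + ‖A' - A‖ := by
  obtain ⟨x, hx, hN⟩ := exists_ne_zero_mul_eq_zero
    (Matrix.of fun l => if l < j then Vᵀ l else V'ᵀ l) j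
  have h1 : ‖A * x‖ ≤ s j * ‖x‖ := h.norm_mul_le_of_forall_lt fun l hl => by
    simpa [Matrix.mul_apply, hl] using hN l hl.ne
  have h2 : s' j * ‖x‖ ≤ ‖A' * x‖ := h'.le_norm_mul_of_forall_gt fun l hl => by
    simpa [Matrix.mul_apply, hl.not_gt] using hN l hl.ne'
  have h3 : ‖A' * x‖ ≤ ‖A * x‖ + ‖A' - A‖ * ‖x‖ := by
    have e : A' * x = A * x + (A' - A) * x := by rw [Matrix.sub_mul]; abel
    rw [e]
    exact (norm_add_le _ _).trans (by gcongr; exact Matrix.frobenius_norm_mul _ _)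
  have hx' : 0 < ‖x‖ := norm_pos_iff.2 hx
  refine le_of_mul_le_mul_right ?_ hx'
  linarith

/-- Weyl's inequality: singular values are Lipschitz functions of the matrix. -/
lemma abs_singular_sub_le {A' U' V' : Matrix (Fin m) (Fin m) ℝ} {s' : Fin m → ℝ}
    (h : IsSVD A U s V) (h' : IsSVD A' U' s' V') (j : Fin m) : |s' j - s j| ≤ ‖A' - A‖ := by
  have h1 := h.singular_le_add h' j
  have h2 := h'.singular_le_add h j
  rw [norm_sub_rev] at h2
  exact abs_le.2 ⟨by linarith, by linarith⟩

/-- The first `k` singular values are bounded below by any lower bound of `‖A x‖ / ‖x‖` on a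
`k`-dimensional space, here the range of `X`. -/
lemma le_singular (h : IsSVD A U s V) {k : ℕ} (hk : k ≤ m) {X : Matrix (Fin m) (Fin k) ℝ}
    (hX : ∀ y : Matrix (Fin k) (Fin 1) ℝ, X * y = 0 → y = 0) {c : ℝ}
    (hc : ∀ y : Matrix (Fin k) (Fin 1) ℝ, c * ‖X * y‖ ≤ ‖A * (X * y)‖) (j : Fin k) :
    c ≤ s (Fin.castLE hk j) := by
  obtain ⟨y, hy, hN⟩ := exists_ne_zero_mul_eq_zero
    ((Vᵀ * X).submatrix (Fin.castLE hk) id) j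
  have h1 : ‖A * (X * y)‖ ≤ s (Fin.castLE hk j) * ‖X * y‖ :=
    h.norm_mul_le_of_forall_lt fun l hl => by
      have hl' : (l : ℕ) < j := hl
      have := hN ⟨l, hl'.trans j.2⟩ (fun e => hl'.ne (congrArg Fin.val e))
      rw [← Matrix.mul_assoc]
      simpa [Matrix.mul_apply] using this
  have hx' : 0 < ‖X * y‖ := norm_pos_iff.2 fun e => hy (hX y e)
  exact le_of_mul_le_mul_right ((hc y).trans h1) hx'

end IsSVD

/-! ### The polar decomposition near the orthogonal group -/

lemma exists_orthogonal_norm_sub_le {k : ℕ} (Q : Matrix (Fin k) (Fin k) ℝ)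
    (hQ : ‖Qᵀ * Q - 1‖ < 1) :
    ∃ Q₀ : Matrix (Fin k) (Fin k) ℝ, Q₀ᵀ * Q₀ = 1 ∧ ‖Q - Q₀‖ ≤ ‖Qᵀ * Q - 1‖ := by
  have hA : (Qᵀ * Q).IsHermitian := by
    simpa using Matrix.isHermitian_conjTranspose_mul_self Q
  obtain ⟨V, l, hV, hV', hs⟩ : ∃ (V : Matrix (Fin k) (Fin k) ℝ) (l : Fin k → ℝ),
      Vᵀ * V = 1 ∧ V * Vᵀ = 1 ∧ Qᵀ * Q = V * Matrix.diagonal l * Vᵀ := by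
    have hu := hA.eigenvectorUnitary.2
    refine ⟨hA.eigenvectorUnitary, hA.eigenvalues, ?_, ?_, ?_⟩
    · simpa [Matrix.star_eq_conjTranspose] using Unitary.star_mul_self_of_mem hu
    · simpa [Matrix.star_eq_conjTranspose] using Unitary.mul_star_self_of_mem hu
    · have := hA.spectral_theorem
      rw [Unitary.conjStarAlgAut_apply] at this
      simpa [Matrix.star_eq_conjTranspose, Function.comp_def] using this
  have hQV : (Q * V)ᵀ * (Q * V) = Matrix.diagonal l := by
    rw [Matrix.transpose_mul, Matrix.mul_assoc, ← Matrix.mul_assoc Qᵀ, hs]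
    simp only [Matrix.mul_assoc, hV, Matrix.mul_one]
    rw [← Matrix.mul_assoc, hV, Matrix.one_mul]
  have hD : ‖Qᵀ * Q - 1‖ = ‖Matrix.diagonal (fun i => l i - 1)‖ := by
    have : Qᵀ * Q - 1 = V * Matrix.diagonal (fun i => l i - 1) * Vᵀ := by
      have : (Matrix.diagonal fun i => l i - 1) = Matrix.diagonal l - 1 := by
        ext i j; by_cases h : i = j <;> simp [h, Matrix.diagonal]
      rw [this, Matrix.mul_sub, Matrix.sub_mul, ← hs, Matrix.mul_one, hV']
    rw [this, norm_mul_of_mul_transpose (by simpa using hV), norm_mul_of_transpose_mul hV]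
  have hl : ∀ i, 0 < l i := fun i => by
    have := abs_entry_le_norm (Matrix.diagonal (fun i => l i - 1)) i i
    rw [Matrix.diagonal_apply_eq, ← hD] at this
    linarith [(abs_le.1 this).1]
  refine ⟨Q * V * Matrix.diagonal (fun i => (√(l i))⁻¹) * Vᵀ, ?_, ?_⟩
  · simp only [Matrix.transpose_mul, Matrix.transpose_transpose, Matrix.diagonal_transpose,
      Matrix.mul_assoc]
    rw [Matrix.transpose_mul, Matrix.mul_assoc] at hQV
    rw [← Matrix.mul_assoc Qᵀ Q, ← Matrix.mul_assoc (Qᵀ * Q) V, ← Matrix.mul_assoc Vᵀ (Qᵀ * Q * V),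
      ← Matrix.mul_assoc Vᵀ (Qᵀ * Q), Matrix.mul_assoc Vᵀ, Matrix.mul_assoc Qᵀ, hQV,
      ← Matrix.mul_assoc (Matrix.diagonal l), ← Matrix.mul_assoc (Matrix.diagonal fun _ => _),
      Matrix.diagonal_mul_diagonal, Matrix.diagonal_mul_diagonal]
    have : (fun i => (√(l i))⁻¹ * (l i * (√(l i))⁻¹)) = fun _ => 1 := by
      funext i
      have h0 : √(l i) ≠ 0 := (Real.sqrt_pos.2 (hl i)).ne'
      field_simp
      rw [Real.sq_sqrt (hl i).le]
    rw [this, Matrix.diagonal_one, Matrix.one_mul, hV']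
  · have e : Q - Q * V * Matrix.diagonal (fun i => (√(l i))⁻¹) * Vᵀ
        = Q * V * Matrix.diagonal (fun i => 1 - (√(l i))⁻¹) * Vᵀ := by
      have : (Matrix.diagonal fun i => 1 - (√(l i))⁻¹) =
          1 - Matrix.diagonal fun i => (√(l i))⁻¹ := by
        ext i j; by_cases h : i = j <;> simp [h, Matrix.diagonal]
      rw [this, Matrix.mul_sub, Matrix.sub_mul, Matrix.mul_one, Matrix.mul_assoc Q V Vᵀ, hV',
        Matrix.mul_one]
    rw [e, norm_mul_of_mul_transpose (by simpa using hV), hD]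
    refine (abs_le_of_sq_le_sq' ?_ (norm_nonneg _)).2
    rw [norm_sq_eq_trace, norm_sq_eq_trace, Matrix.transpose_mul, Matrix.mul_assoc,
      ← Matrix.mul_assoc (Q * V)ᵀ, hQV]
    simp only [Matrix.diagonal_transpose, Matrix.diagonal_mul_diagonal, Matrix.trace_diagonal]
    refine Finset.sum_le_sum fun i _ => ?_
    obtain ⟨r, hr, hr2⟩ : ∃ r, 0 < r ∧ l i = r ^ 2 :=
      ⟨√(l i), Real.sqrt_pos.2 (hl i), (Real.sq_sqrt (hl i).le).symm⟩
    rw [hr2, Real.sqrt_sq hr.le]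
    have : (1 - r⁻¹) * (r ^ 2 * (1 - r⁻¹)) = (r - 1) ^ 2 := by field_simp
    rw [this]
    nlinarith [mul_nonneg (sq_nonneg (r - 1)) hr.le, mul_nonneg (sq_nonneg (r - 1)) (sq_nonneg r)]

/-! ### Alignment of the factors -/

/-- Adding `X diag(s)` with `s ≥ 0` to the product of a positive semidefinite matrix and `X` does
not decrease the norm, because the cross term is a square. -/
lemma norm_mul_le_norm_add {n k p : ℕ} (E : Matrix (Fin n) (Fin p) ℝ)
    (X : Matrix (Fin n) (Fin k) ℝ) {s : Fin k → ℝ} (hs : ∀ j, 0 ≤ s j) :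
    ‖E * Eᵀ * X‖ ≤ ‖X * Matrix.diagonal s + E * Eᵀ * X‖ := by
  set a := X * Matrix.diagonal s with ha
  set b := E * Eᵀ * X with hb
  have h : ‖a + b‖ ^ 2 = ‖a‖ ^ 2 + ‖b‖ ^ 2 + 2 * (aᵀ * b).trace := by
    simp only [norm_sq_eq_trace, Matrix.transpose_add, Matrix.add_mul, Matrix.mul_add,
      Matrix.trace_add]
    have : (bᵀ * a).trace = (aᵀ * b).trace := by
      rw [← Matrix.trace_transpose, Matrix.transpose_mul, Matrix.transpose_transpose]
    rw [this]; ring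
  have h2 : (aᵀ * b).trace = ‖Eᵀ * X * Matrix.diagonal (fun j => √(s j))‖ ^ 2 := by
    have hd : Matrix.diagonal s =
        Matrix.diagonal (fun j => √(s j)) * Matrix.diagonal (fun j => √(s j)) := by
      rw [Matrix.diagonal_mul_diagonal]
      congr 1; funext j; exact (Real.mul_self_sqrt (hs j)).symm
    rw [norm_sq_eq_trace, ha, hb, hd]
    simp only [Matrix.transpose_mul, Matrix.diagonal_transpose, Matrix.transpose_transpose]
    simp only [Matrix.mul_assoc]
    rw [Matrix.trace_mul_comm (Matrix.diagonal fun j => √(s j))]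
    simp only [Matrix.mul_assoc]
  refine (abs_le_of_sq_le_sq' ?_ (norm_nonneg _)).2
  nlinarith [sq_nonneg ‖a‖, sq_nonneg ‖Eᵀ * X * Matrix.diagonal (fun j => √(s j))‖]

section Align

variable {n k : ℕ} {A U V : Matrix (Fin n) (Fin n) ℝ} {s : Fin n → ℝ}

/-- The leading left singular vectors of a perturbation of `E Eᵀ` are almost invariant under
`E Eᵀ`. No spectral gap enters. -/
lemma norm_mul_leading_sub_le (h : IsSVD A U s V) (hk : k ≤ n) (E : Matrix (Fin n) (Fin k) ℝ)
    {ε : ℝ} (hε : ‖A - E * Eᵀ‖ ≤ ε) :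
    ‖E * Eᵀ * U.submatrix id (Fin.castLE hk) -
      U.submatrix id (Fin.castLE hk) * Matrix.diagonal (s ∘ Fin.castLE hk)‖ ≤ 3 * ε := by
  have iso : ∀ W : Matrix (Fin n) (Fin n) ℝ, Wᵀ * W = 1 →
      (W.submatrix id (Fin.castLE hk))ᵀ * W.submatrix id (Fin.castLE hk) = 1 := by
    intro W hW
    have := congrArg (fun X => X.submatrix (Fin.castLE hk) (Fin.castLE hk)) hW
    simp only [Matrix.submatrix_one _ (Fin.castLE_injective hk)] at this
    rw [← this]; rfl
  have cols : ∀ X Y Z : Matrix (Fin n) (Fin n) ℝ, X * Y = Z * Matrix.diagonal s →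
      X * Y.submatrix id (Fin.castLE hk) =
        Z.submatrix id (Fin.castLE hk) * Matrix.diagonal (s ∘ Fin.castLE hk) := by
    intro X Y Z e
    ext i j
    have := congrFun (congrFun e i) (Fin.castLE hk j)
    rw [Matrix.mul_diagonal] at this ⊢
    exact this
  have hU := iso U h.left_tr_mul
  have hV := iso V h.right_tr_mul
  have hAV := cols A V U (by rw [h.eq, Matrix.mul_assoc, h.right_tr_mul, Matrix.mul_one])
  have hAU := cols Aᵀ U V (by
    rw [h.eq, Matrix.transpose_mul, Matrix.transpose_mul, Matrix.diagonal_transpose,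
      Matrix.transpose_transpose, Matrix.mul_assoc, Matrix.mul_assoc, h.left_tr_mul,
      Matrix.mul_one])
  set u := U.submatrix id (Fin.castLE hk)
  set v := V.submatrix id (Fin.castLE hk)
  set D := Matrix.diagonal (s ∘ Fin.castLE hk)
  set X := A - E * Eᵀ with hX
  have hXv : ‖X * v‖ ≤ ε := (norm_mul_le_of_isometry hV X).trans hε
  have hXu : ‖Xᵀ * u‖ ≤ ε :=
    (norm_mul_le_of_isometry hU Xᵀ).trans (by rwa [Matrix.frobenius_norm_transpose])
  have hXT : Xᵀ = Aᵀ - E * Eᵀ := by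
    rw [hX, Matrix.transpose_sub, Matrix.transpose_mul, Matrix.transpose_transpose]
  have e1 : (u - v) * D + E * Eᵀ * (u - v) = X * v - Xᵀ * u := by
    rw [hXT, hX, Matrix.sub_mul, Matrix.sub_mul, Matrix.sub_mul, Matrix.mul_sub, hAV, hAU]
    abel
  have h1 : ‖E * Eᵀ * (u - v)‖ ≤ 2 * ε := by
    refine (norm_mul_le_norm_add E (u - v) (fun j => h.nonneg (Fin.castLE hk j))).trans ?_
    change ‖(u - v) * D + E * Eᵀ * (u - v)‖ ≤ _
    rw [e1]
    exact (norm_sub_le _ _).trans (by linarith)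
  have e2 : E * Eᵀ * u - u * D = E * Eᵀ * (u - v) - X * v := by
    rw [hX, Matrix.sub_mul, Matrix.mul_sub, hAV]
    abel
  rw [e2]
  exact (norm_sub_le _ _).trans (by linarith)

/-- The factor `U_k S_k^{1/2}` of a perturbation of `E Eᵀ` is close to `E Q` for some `Q` that is
close to an orthogonal matrix `Q₀`. The two errors are kept apart since the second one acts on each
row of `E` separately. -/
lemma exists_alignment (h : IsSVD A U s V) (hk : k ≤ n) (E : Matrix (Fin n) (Fin k) ℝ)
    {ε σ₀ : ℝ} (hε : ‖A - E * Eᵀ‖ ≤ ε) (hσ₀ : 3 * ε < σ₀) (hσs : ∀ j, σ₀ ≤ s (Fin.castLE hk j)) :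
    ∃ Q Q₀ : Matrix (Fin k) (Fin k) ℝ, Q₀ᵀ * Q₀ = 1 ∧
      ∀ σ, 0 < σ → (∀ j, σ ≤ s (Fin.castLE hk j)) →
        ‖(Matrix.of fun l j => U l (Fin.castLE hk j) * √(s (Fin.castLE hk j))) - E * Q‖
            ≤ 3 * ε * (√σ)⁻¹ ∧
          ‖Q - Q₀‖ ≤ 3 * ε * σ⁻¹ := by
  have hY := norm_mul_leading_sub_le h hk E hε
  have hε0 : 0 ≤ ε := (norm_nonneg _).trans hε
  have hσ₀0 : 0 < σ₀ := by linarith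
  have hU : (U.submatrix id (Fin.castLE hk))ᵀ * U.submatrix id (Fin.castLE hk) = 1 := by
    have := congrArg (fun X => X.submatrix (Fin.castLE hk) (Fin.castLE hk)) h.left_tr_mul
    simp only [Matrix.submatrix_one _ (Fin.castLE_injective hk)] at this
    rw [← this]; rfl
  have hE : (Matrix.of fun l j => U l (Fin.castLE hk j) * √(s (Fin.castLE hk j))) =
      U.submatrix id (Fin.castLE hk) * Matrix.diagonal (fun j => √(s (Fin.castLE hk j))) := by
    ext l j; simp [Matrix.mul_diagonal]
  rw [hE]
  set u := U.submatrix id (Fin.castLE hk)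
  set S : Fin k → ℝ := s ∘ Fin.castLE hk with hS
  have hSpos : ∀ j, 0 < S j := fun j => hσ₀0.trans_le (hσs j)
  set Y := E * Eᵀ * u - u * Matrix.diagonal S with hYdef
  set R := Matrix.diagonal (fun j => (√(S j))⁻¹) with hR
  have hSR : Matrix.diagonal S * R = Matrix.diagonal (fun j => √(S j)) := by
    rw [hR, Matrix.diagonal_mul_diagonal]
    congr 1; funext j
    have h0 : √(S j) ≠ 0 := (Real.sqrt_pos.2 (hSpos j)).ne'
    field_simp
    rw [Real.sq_sqrt (hSpos j).le]
  have hRSR : R * (Matrix.diagonal S * R) = 1 := by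
    rw [hSR, hR, Matrix.diagonal_mul_diagonal, ← Matrix.diagonal_one]
    congr 1; funext j
    exact inv_mul_cancel₀ (Real.sqrt_pos.2 (hSpos j)).ne'
  have hRT : Rᵀ = R := Matrix.diagonal_transpose _
  have hMu : E * Eᵀ * u = u * Matrix.diagonal S + Y := by rw [hYdef]; abel
  have hRle : ∀ σ, 0 < σ → (∀ j, σ ≤ S j) → ∀ j, |(√(S j))⁻¹| ≤ (√σ)⁻¹ := fun σ hσ hs j => by
    rw [abs_of_nonneg (by positivity)]
    exact inv_anti₀ (Real.sqrt_pos.2 hσ) (Real.sqrt_le_sqrt (hs j))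
  have e1 : u * Matrix.diagonal (fun j => √(S j)) - E * (Eᵀ * u * R) = -(Y * R) := by
    rw [← hSR, ← Matrix.mul_assoc E, ← Matrix.mul_assoc E, hMu, Matrix.add_mul,
      Matrix.mul_assoc u]
    abel
  have e2 : (Eᵀ * u * R)ᵀ * (Eᵀ * u * R) - 1 = R * (uᵀ * Y) * R := by
    have : (Eᵀ * u * R)ᵀ * (Eᵀ * u * R) = R * (uᵀ * (E * Eᵀ * u) * R) := by
      simp only [Matrix.transpose_mul, Matrix.transpose_transpose, hRT, Matrix.mul_assoc]
    rw [this, hMu, Matrix.mul_add, ← Matrix.mul_assoc uᵀ, hU, Matrix.one_mul, Matrix.add_mul,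
      Matrix.mul_add, hRSR, Matrix.mul_assoc R]
    abel
  have huY : ‖uᵀ * Y‖ ≤ 3 * ε := by
    rw [← Matrix.frobenius_norm_transpose, Matrix.transpose_mul, Matrix.transpose_transpose]
    exact (norm_mul_le_of_isometry hU _).trans (by rwa [Matrix.frobenius_norm_transpose])
  have hQ : ∀ σ, 0 < σ → (∀ j, σ ≤ S j) →
      ‖(Eᵀ * u * R)ᵀ * (Eᵀ * u * R) - 1‖ ≤ 3 * ε * σ⁻¹ := fun σ hσ hs => by
    have hσ' : (0 : ℝ) ≤ (√σ)⁻¹ := by positivity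
    rw [e2]
    calc ‖R * (uᵀ * Y) * R‖ ≤ ‖R * (uᵀ * Y)‖ * (√σ)⁻¹ := norm_mul_diagonal_le hσ' (hRle σ hσ hs)
      _ ≤ (√σ)⁻¹ * ‖uᵀ * Y‖ * (√σ)⁻¹ := by
          gcongr
          exact norm_diagonal_mul_le hσ' fun i _ => Or.inr (hRle σ hσ hs i)
      _ ≤ (√σ)⁻¹ * (3 * ε) * (√σ)⁻¹ := by gcongr
      _ = 3 * ε * σ⁻¹ := by
          rw [mul_comm (√σ)⁻¹, mul_assoc, ← mul_inv, Real.mul_self_sqrt hσ.le]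
  obtain ⟨Q₀, hQ₀, hQQ₀⟩ := exists_orthogonal_norm_sub_le (Eᵀ * u * R) (by
    refine (hQ σ₀ hσ₀0 hσs).trans_lt ?_
    rwa [← div_eq_mul_inv, div_lt_one hσ₀0])
  refine ⟨Eᵀ * u * R, Q₀, hQ₀, fun σ hσ hs => ⟨?_, hQQ₀.trans (hQ σ hσ hs)⟩⟩
  change ‖u * Matrix.diagonal (fun j => √(S j)) - _‖ ≤ _
  rw [e1, norm_neg]
  refine (norm_mul_diagonal_le (by positivity) (hRle σ hσ hs)).trans ?_
  gcongr

/-- Lower bound of the leading singular values of a perturbation of `E Eᵀ`, in terms of a lower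
bound `1 / b` of the smallest singular value of `E`. -/
lemma sub_le_leading_singular (h : IsSVD A U s V) (hk : k ≤ n) {E : Matrix (Fin n) (Fin k) ℝ}
    {ε b : ℝ} (hε : ‖A - E * Eᵀ‖ ≤ ε) (hb : 0 < b)
    (hE : ∀ y : Matrix (Fin k) (Fin 1) ℝ, ‖y‖ ≤ b * ‖E * y‖) (j : Fin k) :
    (b ^ 2)⁻¹ - ε ≤ s (Fin.castLE hk j) := by
  refine h.le_singular hk (X := E) (fun y hy => ?_) (fun y => ?_) j
  · have := hE y
    rw [hy, norm_zero, mul_zero] at this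
    exact norm_le_zero_iff.1 this
  set x := E * y with hx
  set z := Eᵀ * x with hz
  have h1 : ‖x‖ ^ 2 ≤ ‖y‖ * ‖z‖ := by
    have : ‖x‖ ^ 2 = (yᵀ * z) 0 0 := by
      have e : xᵀ * x = yᵀ * z := by rw [hz, hx, Matrix.transpose_mul, Matrix.mul_assoc]
      rw [norm_sq_eq_trace, e]
      simp [Matrix.trace]
    rw [this]
    refine (le_abs_self _).trans ((abs_entry_le_norm _ _ _).trans ?_)
    rw [← Matrix.frobenius_norm_transpose y]
    exact Matrix.frobenius_norm_mul _ _
  have h2 : ‖x‖ ≤ b * ‖z‖ := by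
    rcases (norm_nonneg x).eq_or_lt with h0 | h0
    · rw [← h0]; positivity
    · refine le_of_mul_le_mul_right ?_ h0
      nlinarith [hE y, norm_nonneg z]
  have h3 : ‖x‖ ≤ b ^ 2 * ‖E * Eᵀ * x‖ := by
    have := hE z
    rw [Matrix.mul_assoc]
    nlinarith
  have h4 : ‖E * Eᵀ * x‖ ≤ ‖A * x‖ + ε * ‖x‖ := by
    have e : E * Eᵀ * x = A * x - (A - E * Eᵀ) * x := by rw [Matrix.sub_mul]; abel
    rw [e]
    refine (norm_sub_le _ _).trans ?_
    gcongr
    exact (Matrix.frobenius_norm_mul _ _).trans (by gcongr)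
  have h5 : (b ^ 2)⁻¹ * ‖x‖ ≤ ‖E * Eᵀ * x‖ := by
    rw [inv_mul_le_iff₀ (by positivity)]; exact h3
  linarith

end Align

/-! ### The pseudoinverse -/

section Pinv

variable {ι : Type*} [Fintype ι] {k : ℕ}

lemma pinv_mul_self {E : Matrix ι (Fin k) ℝ} (hE : IsUnit (Eᵀ * E).det) : pinv E * E = 1 := by
  rw [pinv, Matrix.mul_assoc, Matrix.nonsing_inv_mul _ hE]

lemma transpose_mul_self_mul (E : Matrix ι (Fin k) ℝ) (Q : Matrix (Fin k) (Fin k) ℝ) :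
    (E * Q)ᵀ * (E * Q) = Qᵀ * (Eᵀ * E) * Q := by
  simp only [Matrix.transpose_mul, Matrix.mul_assoc]

lemma pinv_mul_orthogonal {E : Matrix ι (Fin k) ℝ} {Q : Matrix (Fin k) (Fin k) ℝ}
    (hQ : Qᵀ * Q = 1) : pinv (E * Q) = Qᵀ * pinv E := by
  have hi : Q⁻¹ = Qᵀ := Matrix.inv_eq_left_inv hQ
  have hi' : (Qᵀ)⁻¹ = Q := Matrix.inv_eq_left_inv (mul_eq_one_comm.1 hQ)
  rw [pinv, transpose_mul_self_mul, Matrix.mul_inv_rev, Matrix.mul_inv_rev, hi, hi',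
    pinv, Matrix.transpose_mul]
  simp only [Matrix.mul_assoc]
  rw [← Matrix.mul_assoc Q Qᵀ, mul_eq_one_comm.1 hQ, Matrix.one_mul]

lemma norm_le_norm_pinv_mul {E : Matrix ι (Fin k) ℝ} (hE : IsUnit (Eᵀ * E).det)
    (y : Matrix (Fin k) (Fin 1) ℝ) : ‖y‖ ≤ ‖pinv E‖ * ‖E * y‖ := by
  have : y = pinv E * (E * y) := by rw [← Matrix.mul_assoc, pinv_mul_self hE, Matrix.one_mul]
  calc ‖y‖ = ‖pinv E * (E * y)‖ := by rw [← this]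
    _ ≤ _ := Matrix.frobenius_norm_mul _ _

variable [DecidableEq ι]

/-- Full column rank is stable, with the bound `‖F⋆‖ ≤ 2 ‖E⋆‖`. It comes from
`F⋆ = E⋆ (F F⋆) - E⋆ (F - E) F⋆`, in which `F F⋆` is an orthogonal projection. -/
lemma isUnit_and_norm_pinv_le {E F : Matrix ι (Fin k) ℝ} (hE : IsUnit (Eᵀ * E).det) {δ : ℝ}
    (hδ : ‖F - E‖ ≤ δ) (hb : ‖pinv E‖ * δ ≤ 1 / 2) :
    IsUnit (Fᵀ * F).det ∧ ‖pinv F‖ ≤ 2 * ‖pinv E‖ := by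
  have hEδ : ‖pinv E * (F - E)‖ ≤ 1 / 2 :=
    (Matrix.frobenius_norm_mul _ _).trans ((by gcongr : _ ≤ ‖pinv E‖ * δ).trans hb)
  have e1 : pinv E * F = 1 + pinv E * (F - E) := by
    rw [Matrix.mul_sub, pinv_mul_self hE]; abel
  have hF : IsUnit (Fᵀ * F).det := by
    rw [isUnit_iff_ne_zero]
    intro h0
    obtain ⟨v, hv, h⟩ := Matrix.exists_mulVec_eq_zero_iff.2 h0
    have hFv : F *ᵥ v = 0 := by
      have h' : v ⬝ᵥ ((Fᵀ * F) *ᵥ v) = 0 := by rw [h]; simp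
      rw [← Matrix.mulVec_mulVec, Matrix.dotProduct_mulVec, Matrix.vecMul_transpose] at h'
      exact dotProduct_self_eq_zero.1 h'
    set y : Matrix (Fin k) (Fin 1) ℝ := Matrix.replicateCol (Fin 1) v with hy
    have hFy : F * y = 0 := by
      rw [hy, ← Matrix.replicateCol_mulVec, hFv]; ext; simp
    have h2 : y = -(pinv E * (F - E) * y) := by
      have : pinv E * F * y = 0 := by rw [Matrix.mul_assoc, hFy, Matrix.mul_zero]
      rw [e1, Matrix.add_mul, Matrix.one_mul] at this
      exact eq_neg_of_add_eq_zero_left this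
    have h3 : ‖y‖ ≤ 1 / 2 * ‖y‖ := by
      calc ‖y‖ = ‖pinv E * (F - E) * y‖ := by conv_lhs => rw [h2, norm_neg]
        _ ≤ ‖pinv E * (F - E)‖ * ‖y‖ := Matrix.frobenius_norm_mul _ _
        _ ≤ _ := by gcongr
    have h4 : y = 0 := norm_le_zero_iff.1 (by linarith)
    exact hv (funext fun l => by simpa [hy] using congrFun (congrFun h4 l) 0)
  refine ⟨hF, ?_⟩
  have hP : (F * pinv F)ᵀ = F * pinv F := by
    have : ((Fᵀ * F)⁻¹)ᵀ = (Fᵀ * F)⁻¹ := by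
      rw [Matrix.transpose_nonsing_inv, Matrix.transpose_mul, Matrix.transpose_transpose]
    rw [pinv, Matrix.transpose_mul, Matrix.transpose_mul, Matrix.transpose_transpose, this,
      Matrix.mul_assoc]
  have hPP : F * pinv F * (F * pinv F) = F * pinv F := by
    rw [Matrix.mul_assoc, ← Matrix.mul_assoc (pinv F), pinv_mul_self hF, Matrix.one_mul]
  have e2 : pinv F = pinv E * (F * pinv F) - pinv E * (F - E) * pinv F := by
    rw [← Matrix.mul_assoc, ← Matrix.sub_mul, e1]; simp
  have h1 : ‖pinv F‖ ≤ ‖pinv E‖ + 1 / 2 * ‖pinv F‖ := by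
    calc ‖pinv F‖ = ‖pinv E * (F * pinv F) - pinv E * (F - E) * pinv F‖ := by rw [← e2]
      _ ≤ ‖pinv E * (F * pinv F)‖ + ‖pinv E * (F - E) * pinv F‖ := norm_sub_le _ _
      _ ≤ _ := by
        gcongr
        · exact norm_mul_le_of_projection hP hPP _
        · exact (Matrix.frobenius_norm_mul _ _).trans (by gcongr)
  linarith

/-- Perturbation of `E⋆ T (E⋆)ᵀ` for `T = E D Eᵀ`, with constants in terms of `‖E⋆‖` and `‖T‖`. -/
lemma norm_pinv_mul_mul_sub_le {E F : Matrix ι (Fin k) ℝ} (hE : IsUnit (Eᵀ * E).det)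
    {D : Matrix (Fin k) (Fin k) ℝ} {T T' : Matrix ι ι ℝ} (hT : T = E * D * Eᵀ) {δ ε : ℝ}
    (hδ : ‖F - E‖ ≤ δ) (hb : ‖pinv E‖ * δ ≤ 1 / 2) (hε : ‖T' - T‖ ≤ ε) :
    ‖pinv F * T' * (pinv F)ᵀ - D‖ ≤ 4 * ‖pinv E‖ ^ 2 * ε + 6 * ‖pinv E‖ ^ 3 * ‖T‖ * δ := by
  obtain ⟨hF, hFb⟩ := isUnit_and_norm_pinv_le hE hδ hb
  have hδ0 : 0 ≤ δ := (norm_nonneg _).trans hδ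
  have hε0 : 0 ≤ ε := (norm_nonneg _).trans hε
  set b := ‖pinv E‖ with hbdef
  have hb0 : 0 ≤ b := norm_nonneg _
  have hD : ‖D‖ ≤ b ^ 2 * ‖T‖ := by
    have : D = pinv E * T * (pinv E)ᵀ := by
      have h1 := pinv_mul_self hE
      have h2 : Eᵀ * (pinv E)ᵀ = 1 := by rw [← Matrix.transpose_mul, h1, Matrix.transpose_one]
      rw [hT]
      simp only [Matrix.mul_assoc]
      rw [h2, Matrix.mul_one, ← Matrix.mul_assoc, h1, Matrix.one_mul]
    calc ‖D‖ = ‖pinv E * T * (pinv E)ᵀ‖ := by rw [← this]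
      _ ≤ ‖pinv E * T‖ * ‖(pinv E)ᵀ‖ := Matrix.frobenius_norm_mul _ _
      _ ≤ (‖pinv E‖ * ‖T‖) * ‖pinv E‖ := by
          rw [Matrix.frobenius_norm_transpose]
          gcongr
          exact Matrix.frobenius_norm_mul _ _
      _ = _ := by rw [← hbdef]; ring
  set N := pinv F * (F - E) with hN
  have hNle : ‖N‖ ≤ 2 * b * δ := (Matrix.frobenius_norm_mul _ _).trans (by gcongr)
  have hFE : pinv F * E = 1 - N := by rw [hN, Matrix.mul_sub, pinv_mul_self hF]; abel
  have hFE' : Eᵀ * (pinv F)ᵀ = 1 - Nᵀ := by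
    rw [← Matrix.transpose_mul, hFE, Matrix.transpose_sub, Matrix.transpose_one]
  have e : pinv F * T' * (pinv F)ᵀ - D =
      pinv F * (T' - T) * (pinv F)ᵀ - N * D - D * Nᵀ + N * D * Nᵀ := by
    have h1 : pinv F * T * (pinv F)ᵀ = (1 - N) * D * (1 - Nᵀ) := by
      rw [hT, ← hFE, ← hFE']; simp only [Matrix.mul_assoc]
    have h2 : pinv F * (T' - T) * (pinv F)ᵀ =
        pinv F * T' * (pinv F)ᵀ - (1 - N) * D * (1 - Nᵀ) := by
      rw [Matrix.mul_sub, Matrix.sub_mul, h1]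
    rw [h2]
    simp only [Matrix.sub_mul, Matrix.mul_sub, Matrix.one_mul, Matrix.mul_one]
    abel
  have n1 : ‖pinv F * (T' - T) * (pinv F)ᵀ‖ ≤ 2 * b * ε * (2 * b) := by
    refine (Matrix.frobenius_norm_mul _ _).trans ?_
    rw [Matrix.frobenius_norm_transpose]
    gcongr
    exact (Matrix.frobenius_norm_mul _ _).trans (by gcongr)
  have n2 : ‖N * D‖ ≤ 2 * b * δ * (b ^ 2 * ‖T‖) :=
    (Matrix.frobenius_norm_mul _ _).trans (by gcongr)
  have n3 : ‖D * Nᵀ‖ ≤ b ^ 2 * ‖T‖ * (2 * b * δ) := by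
    refine (Matrix.frobenius_norm_mul _ _).trans ?_
    rw [Matrix.frobenius_norm_transpose]
    gcongr
  have n4 : ‖N * D * Nᵀ‖ ≤ 2 * b * δ * (b ^ 2 * ‖T‖) * (2 * b * δ) := by
    refine (Matrix.frobenius_norm_mul _ _).trans ?_
    rw [Matrix.frobenius_norm_transpose]
    gcongr
  have n5 : 2 * b * δ * (b ^ 2 * ‖T‖) * (2 * b * δ) ≤ 2 * b * δ * (b ^ 2 * ‖T‖) * 1 := by
    gcongr
    linarith
  rw [e]
  refine (norm_add_le _ _).trans ?_
  refine (add_le_add ((norm_sub_le _ _).trans (add_le_add (norm_sub_le _ _) le_rfl)) le_rfl).trans ?_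
  calc _ ≤ 2 * b * ε * (2 * b) + 2 * b * δ * (b ^ 2 * ‖T‖) + b ^ 2 * ‖T‖ * (2 * b * δ)
        + 2 * b * δ * (b ^ 2 * ‖T‖) * 1 := by linarith
    _ = _ := by ring

end Pinv

/-! ### Singular vectors near a diagonal matrix -/

section Euclidean

variable {k : ℕ}

lemma norm_toLp_le {v : Fin k → ℝ} {c : ℝ} (hc : 0 ≤ c) (h : ∀ j, |v j| ≤ c) :
    ‖WithLp.toLp 2 v‖ ≤ √k * c := by
  rw [EuclideanSpace.norm_eq]
  calc √(∑ j, ‖v j‖ ^ 2) ≤ √(∑ _j : Fin k, c ^ 2) := by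
        gcongr with j
        exact h j
    _ = √k * c := by simp [Real.sqrt_sq hc]

lemma norm_toLp_diag_le (X : Matrix (Fin k) (Fin k) ℝ) :
    ‖WithLp.toLp 2 (fun j => X j j)‖ ≤ ‖X‖ := by
  refine abs_le_of_sq_le_sq' ?_ (norm_nonneg _) |>.2
  rw [EuclideanSpace.norm_sq_eq, norm_sq_eq_sum]
  refine Finset.sum_le_sum fun j _ => ?_
  simpa using Finset.single_le_sum (f := fun l => X j l ^ 2) (fun _ _ => sq_nonneg _)
    (Finset.mem_univ j)

end Euclidean

section Diagonal

variable {k : ℕ} {d : Fin k → ℝ} {π : Equiv.Perm (Fin k)}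

lemma isSVD_diagonal (hd : ∀ l, 0 ≤ d l) (hπ : Antitone (d ∘ π)) :
    IsSVD (Matrix.diagonal d) ((1 : Matrix (Fin k) (Fin k) ℝ).submatrix id π) (d ∘ π)
      ((1 : Matrix (Fin k) (Fin k) ℝ).submatrix id π) := by
  have ho : (1 : Matrix (Fin k) (Fin k) ℝ).submatrix id π ∈ Matrix.orthogonalGroup (Fin k) ℝ := by
    rw [Matrix.mem_orthogonalGroup_iff, Matrix.transpose_submatrix, Matrix.submatrix_mul_equiv]
    simp
  refine ⟨ho, ho, fun _ => hd _, hπ, ?_⟩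
  have : Matrix.diagonal (d ∘ π) = (Matrix.diagonal d).submatrix π π := by simp
  rw [this, Matrix.transpose_submatrix, Matrix.submatrix_mul_equiv, Matrix.submatrix_mul_equiv]
  simp

/-- The left singular vectors of a perturbation of a diagonal matrix with distinct nonnegative
entries are signed unit vectors, up to an error of the order of the perturbation. The constant may
depend on the diagonal matrix, as it enters the reconstruction error only quadratically. -/
lemma abs_left_singular_le {G B W : Matrix (Fin k) (Fin k) ℝ} {s : Fin k → ℝ}
    (h : IsSVD G B s W) (hd : ∀ l, 0 ≤ d l) (hπ : Antitone (d ∘ π)) {g δ : ℝ}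
    (hg : 0 < g) (hgap : ∀ l l', l ≠ l' → g ≤ |d l - d l'|) (hδ : ‖G - Matrix.diagonal d‖ ≤ δ)
    (hδ1 : δ ≤ 1) (hδg : 2 * δ ≤ g) {l j : Fin k} (hl : l ≠ π j) :
    |B l j| ≤ 4 * (2 * ‖Matrix.diagonal d‖ + 1) / g ^ 2 * δ := by
  have hs : |s j - d (π j)| ≤ δ := ((isSVD_diagonal hd hπ).abs_singular_sub_le h j).trans hδ
  have hδ0 : 0 ≤ δ := (norm_nonneg _).trans hδ
  set D := Matrix.diagonal d with hD
  set Δ := G - D with hΔ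
  -- The squares of the singular values and the columns of `B` are eigenpairs of `G Gᵀ`.
  set R := G * Gᵀ - D * D with hR
  have hRB : D * D * B + R * B = B * Matrix.diagonal (fun j => s j * s j) := by
    have e : G * Gᵀ * B = B * Matrix.diagonal (fun j => s j * s j) := by
      rw [← Matrix.diagonal_mul_diagonal, h.eq, Matrix.transpose_mul, Matrix.transpose_mul,
        Matrix.diagonal_transpose, Matrix.transpose_transpose]
      simp only [Matrix.mul_assoc]
      rw [h.left_tr_mul, Matrix.mul_one, ← Matrix.mul_assoc Wᵀ, h.right_tr_mul, Matrix.one_mul]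
    rw [← e, hR, Matrix.sub_mul]; abel
  have hentry : (d l * d l - s j * s j) * B l j = -(R * B) l j := by
    have := congrFun (congrFun hRB l) j
    rw [Matrix.add_apply, Matrix.mul_diagonal, hD, Matrix.diagonal_mul_diagonal,
      Matrix.diagonal_mul] at this
    linarith
  have hRn : ‖R‖ ≤ (2 * ‖D‖ + 1) * δ := by
    have e : R = D * Δᵀ + Δ * D + Δ * Δᵀ := by
      have hDT : Dᵀ = D := Matrix.diagonal_transpose _
      rw [hR, hΔ, Matrix.transpose_sub, hDT, Matrix.mul_sub, Matrix.sub_mul, Matrix.mul_sub,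
        Matrix.sub_mul, Matrix.sub_mul]
      abel
    have m1 : ‖D * Δᵀ‖ ≤ ‖D‖ * δ := (Matrix.frobenius_norm_mul _ _).trans (by
      rw [Matrix.frobenius_norm_transpose]; gcongr)
    have m2 : ‖Δ * D‖ ≤ δ * ‖D‖ := (Matrix.frobenius_norm_mul _ _).trans (by gcongr)
    have m3 : ‖Δ * Δᵀ‖ ≤ δ * 1 := (Matrix.frobenius_norm_mul _ _).trans (by
      rw [Matrix.frobenius_norm_transpose]; gcongr; exact hδ.trans hδ1)
    rw [e]
    refine (norm_add_le _ _).trans ((add_le_add (norm_add_le _ _) le_rfl).trans ?_)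
    linarith
  have hRBn : |(R * B) l j| ≤ (2 * ‖D‖ + 1) * δ := by
    refine (abs_entry_le_norm _ _ _).trans ?_
    rwa [norm_mul_of_mul_transpose h.left_mul_tr]
  have hsep : g ^ 2 / 4 ≤ |d l * d l - s j * s j| := by
    have h1 := hgap l (π j) hl
    have h2 : g / 2 ≤ |d l - s j| := by
      have : |d l - d (π j)| ≤ |d l - s j| + |s j - d (π j)| := abs_sub_le _ _ _
      linarith
    have h3 : g / 2 ≤ d l + s j := by
      have : |d l - d (π j)| ≤ d l + d (π j) :=
        abs_le.2 ⟨by linarith [hd l, hd (π j)], by linarith [hd l, hd (π j)]⟩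
      linarith [(abs_le.1 hs).1]
    have e : d l * d l - s j * s j = (d l - s j) * (d l + s j) := by ring
    rw [e, abs_mul, abs_of_nonneg (by linarith : 0 ≤ d l + s j)]
    calc g ^ 2 / 4 = g / 2 * (g / 2) := by ring
      _ ≤ _ := by gcongr
  have hfin : g ^ 2 / 4 * |B l j| ≤ (2 * ‖D‖ + 1) * δ := by
    calc g ^ 2 / 4 * |B l j| ≤ |d l * d l - s j * s j| * |B l j| := by gcongr
      _ = |(R * B) l j| := by rw [← abs_mul, hentry, abs_neg]
      _ ≤ _ := hRBn
  have e : 4 * (2 * ‖D‖ + 1) / g ^ 2 * δ = (2 * ‖D‖ + 1) * δ / (g ^ 2 / 4) := by field_simp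
  rw [e, le_div_iff₀ (by positivity)]
  linarith

/-- The diagonal of `Bᵀ diag(d) B` depends on the orthogonal matrix `B` only to second order near
the signed permutation matrices. -/
lemma norm_diag_conj_sub_le {B : Matrix (Fin k) (Fin k) ℝ} (hB : Bᵀ * B = 1) {η : ℝ}
    (hη : ∀ j l, l ≠ π j → |B l j| ≤ η) :
    ‖WithLp.toLp 2 (fun j => d (π j) - (Bᵀ * Matrix.diagonal d * B) j j)‖ ≤
      √k * (k * (2 * ‖Matrix.diagonal d‖ * η ^ 2)) := by
  refine norm_toLp_le (by positivity) fun j => ?_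
  have hone : ∑ l, B l j * B l j = 1 := by
    have := congrFun (congrFun hB j) j
    simpa [Matrix.mul_apply] using this
  have e : d (π j) - (Bᵀ * Matrix.diagonal d * B) j j =
      ∑ l, (d (π j) - d l) * (B l j * B l j) := by
    simp only [sub_mul, Finset.sum_sub_distrib, ← Finset.mul_sum, hone, mul_one]
    rw [Matrix.mul_apply]
    congr 1
    refine Finset.sum_congr rfl fun l _ => ?_
    rw [Matrix.mul_diagonal, Matrix.transpose_apply]; ring
  rw [e]
  refine (Finset.abs_sum_le_sum_abs _ _).trans ?_
  refine (Finset.sum_le_card_nsmul _ _ (2 * ‖Matrix.diagonal d‖ * η ^ 2) fun l _ => ?_).trans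
    (by simp)
  by_cases hl : l = π j
  · rw [hl, sub_self, zero_mul, abs_zero]; positivity
  have hd : ∀ l, |d l| ≤ ‖Matrix.diagonal d‖ := fun l => by
    simpa using abs_entry_le_norm (Matrix.diagonal d) l l
  have h1 : |d (π j) - d l| ≤ 2 * ‖Matrix.diagonal d‖ :=
    (abs_sub _ _).trans (by linarith [hd (π j), hd l])
  have h2 : B l j * B l j ≤ η ^ 2 := by
    rw [← sq, ← sq_abs]
    exact pow_le_pow_left₀ (abs_nonneg _) (hη j l hl) 2
  rw [abs_mul, abs_of_nonneg (mul_self_nonneg (B l j))]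
  exact mul_le_mul h1 h2 (mul_self_nonneg _) (by positivity)

end Diagonal

/-! ### Moments and their factors -/

section Moments

variable {n k : ℕ}

/-- The factor `M diag(Ω)^{1/2}` of `M₂`. For this factor the core slices are diagonal, with the
rows of `M` on the diagonals. -/
noncomputable def momentFactor (M : Matrix (Fin n) (Fin k) ℝ) (ω : Fin k → ℝ) :
    Matrix (Fin n) (Fin k) ℝ :=
  M * Matrix.diagonal fun j => √(ω j)

lemma momentFactor_mul_transpose (M : Matrix (Fin n) (Fin k) ℝ) {ω : Fin k → ℝ}
    (hω : ∀ j, 0 ≤ ω j) : momentFactor M ω * (momentFactor M ω)ᵀ = secondMoment M ω := by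
  rw [momentFactor, secondMoment, Matrix.transpose_mul, Matrix.diagonal_transpose,
    Matrix.mul_assoc, ← Matrix.mul_assoc (Matrix.diagonal _), Matrix.diagonal_mul_diagonal,
    ← Matrix.mul_assoc]
  simp only [Real.mul_self_sqrt (hω _)]

lemma removeRow_mul {p : ℕ} (E : Matrix (Fin n) (Fin k) ℝ) (Q : Matrix (Fin k) (Fin p) ℝ)
    (i : Fin n) : removeRow (E * Q) i = removeRow E i * Q := rfl

lemma removeRow_mul_transpose {E F : Matrix (Fin n) (Fin k) ℝ} (h : E * Eᵀ = F * Fᵀ) (i : Fin n) :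
    removeRow E i * (removeRow E i)ᵀ = removeRow F i * (removeRow F i)ᵀ := by
  ext l m
  exact congrFun (congrFun h l) m

lemma norm_removeRow_le (E : Matrix (Fin n) (Fin k) ℝ) (i : Fin n) : ‖removeRow E i‖ ≤ ‖E‖ := by
  refine (abs_le_of_sq_le_sq' ?_ (norm_nonneg _)).2
  rw [norm_sq_eq_sum, norm_sq_eq_sum]
  change ∑ l : Without i, ∑ j, E l j ^ 2 ≤ _
  rw [← Finset.sum_subtype (Finset.univ.filter (· ≠ i)) (by simp) (fun l => ∑ j, E l j ^ 2)]
  exact Finset.sum_le_sum_of_subset_of_nonneg (Finset.subset_univ _) fun _ _ _ => by positivity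

lemma isUnit_of_rank (M : Matrix (Fin n) (Fin k) ℝ) {ω : Fin k → ℝ} (hω : ∀ j, 0 ≤ ω j)
    {i : Fin n} (h : (secondMoment (removeRow M i) ω).rank = k) :
    IsUnit ((removeRow (momentFactor M ω) i)ᵀ * removeRow (momentFactor M ω) i).det := by
  have e : secondMoment (removeRow M i) ω =
      removeRow (momentFactor M ω) i * (removeRow (momentFactor M ω) i)ᵀ := by
    ext l m
    have := congrFun (congrFun (momentFactor_mul_transpose M hω) l) m
    exact this.symm
  rw [e, Matrix.rank_self_mul_transpose, ← Matrix.rank_transpose_mul_self] at h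
  rw [← Matrix.isUnit_iff_isUnit_det]
  rw [← Matrix.mulVec_surjective_iff_isUnit]
  exact (LinearMap.range_eq_top (f := Matrix.mulVecLin _)).1
    (Submodule.eq_top_of_finrank_eq (h.trans (by simp)))

lemma slice_thirdMoment (M : Matrix (Fin n) (Fin k) ℝ) {ω : Fin k → ℝ} (hω : ∀ j, 0 ≤ ω j)
    (i : Fin n) : slice (thirdMoment M ω) i =
      removeRow (momentFactor M ω) i * Matrix.diagonal (M i) *
        (removeRow (momentFactor M ω) i)ᵀ := by
  ext l h
  rw [Matrix.mul_apply]
  simp only [slice, thirdMoment, Matrix.of_apply, Matrix.mul_diagonal, Matrix.transpose_apply,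
    removeRow, momentFactor]
  refine Finset.sum_congr rfl fun j _ => ?_
  have := Real.mul_self_sqrt (hω j)
  linear_combination (-(M l j * M h j * M i j)) * this

lemma norm_slice_sub_le (T T' : Fin n → Fin n → Fin n → ℝ) (i : Fin n) :
    ‖slice T' i - slice T i‖ ≤ tensorNorm (T' - T) := by
  rw [tensorNorm]
  refine Real.le_sqrt_of_sq_le ?_
  rw [norm_sq_eq_sum]
  have h1 : ∀ l h, (T' l h i - T l h i) ^ 2 ≤ ∑ m, (T' - T) l h m ^ 2 := fun l h => by
    simpa using Finset.single_le_sum (f := fun m => (T' - T) l h m ^ 2)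
      (fun _ _ => sq_nonneg _) (Finset.mem_univ i)
  have h2 : ∀ f : Fin n → ℝ, (∀ l, 0 ≤ f l) → ∑ l : Without i, f l ≤ ∑ l, f l := fun f hf => by
    rw [← Finset.sum_subtype (Finset.univ.filter (· ≠ i)) (by simp) f]
    exact Finset.sum_le_sum_of_subset_of_nonneg (Finset.subset_univ _) fun _ _ _ => hf _
  calc ∑ l : Without i, ∑ h : Without i, (slice T' i - slice T i) l h ^ 2
      ≤ ∑ l : Without i, ∑ h : Without i, ∑ m, (T' - T) l h m ^ 2 :=
        Finset.sum_le_sum fun l _ => Finset.sum_le_sum fun h _ => h1 l h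
    _ ≤ ∑ l : Without i, ∑ h, ∑ m, (T' - T) l h m ^ 2 :=
        Finset.sum_le_sum fun l _ =>
          h2 (fun h => ∑ m, (T' - T) l h m ^ 2) fun _ => by positivity
    _ ≤ _ := h2 (fun l => ∑ h, ∑ m, (T' - T) l h m ^ 2) fun _ => by positivity

lemma coreSlice_mul_orthogonal (E : Matrix (Fin n) (Fin k) ℝ) {Q : Matrix (Fin k) (Fin k) ℝ}
    (hQ : Qᵀ * Q = 1) (T : Fin n → Fin n → Fin n → ℝ) (i : Fin n) :
    coreSlice (E * Q) T i = Qᵀ * coreSlice E T i * Q := by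
  rw [coreSlice, coreSlice, removeRow_mul, pinv_mul_orthogonal hQ]
  simp only [Matrix.transpose_mul, Matrix.transpose_transpose, Matrix.mul_assoc]

/-- Two factors of the same positive semidefinite matrix, one of full column rank, differ by an
orthogonal matrix. -/
lemma exists_orthogonal_of_mul_transpose_eq {ι : Type*} [Fintype ι] [DecidableEq ι]
    {E F : Matrix ι (Fin k) ℝ} (hF : IsUnit (Fᵀ * F).det) (h : E * Eᵀ = F * Fᵀ) :
    ∃ Q : Matrix (Fin k) (Fin k) ℝ, Qᵀ * Q = 1 ∧ E = F * Q := by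
  have hl := pinv_mul_self hF
  refine ⟨pinv F * E, ?_, ?_⟩
  · rw [mul_eq_one_comm, Matrix.transpose_mul, Matrix.mul_assoc, ← Matrix.mul_assoc E, h,
      Matrix.mul_assoc, ← Matrix.mul_assoc, hl, Matrix.one_mul, ← Matrix.transpose_mul, hl,
      Matrix.transpose_one]
  · set Z := (1 - F * pinv F) * E with hZ
    have hP : (1 - F * pinv F) * F = 0 := by
      rw [Matrix.sub_mul, Matrix.mul_assoc, hl]; simp
    have h0 : Z * Zᵀ = 0 := by
      rw [hZ, Matrix.transpose_mul, Matrix.mul_assoc, ← Matrix.mul_assoc E, h, Matrix.mul_assoc F,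
        ← Matrix.mul_assoc, hP, Matrix.zero_mul]
    have h1 : ‖Z‖ ^ 2 = 0 := by
      rw [norm_sq_eq_trace, Matrix.trace_mul_comm, h0, Matrix.trace_zero]
    have h2 : Z = 0 := norm_eq_zero.1 (pow_eq_zero_iff two_ne_zero |>.1 h1)
    rw [hZ, Matrix.sub_mul, Matrix.one_mul, Matrix.mul_assoc] at h2
    exact sub_eq_zero.1 h2

lemma norm_factor_eq {ι : Type*} [Fintype ι] [DecidableEq ι]
    {E F : Matrix ι (Fin k) ℝ} (hF : IsUnit (Fᵀ * F).det) (h : E * Eᵀ = F * Fᵀ) :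
    ‖E‖ = ‖F‖ ∧ ‖pinv E‖ = ‖pinv F‖ := by
  obtain ⟨Q, hQ, rfl⟩ := exists_orthogonal_of_mul_transpose_eq hF h
  have hQ' := mul_eq_one_comm.1 hQ
  rw [pinv_mul_orthogonal hQ]
  exact ⟨norm_mul_of_mul_transpose hQ' F, norm_mul_of_transpose_mul (by simpa using hQ') _⟩

lemma rowGap_le (M : Matrix (Fin n) (Fin k) ℝ) (r : Fin n) {l l' : Fin k} (h : l ≠ l') :
    rowGap M r ≤ |M r l - M r l'| :=
  ciInf_le (f := fun p : {p : Fin k × Fin k // p.1 ≠ p.2} => |M r p.1.1 - M r p.1.2|)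
    (Set.finite_range _).bddBelow ⟨(l, l'), h⟩

lemma exists_perm_strictAnti {d : Fin k → ℝ} (hd : Function.Injective d) :
    ∃ π : Equiv.Perm (Fin k), StrictAnti fun j => d (π j) := by
  refine ⟨Tuple.sort (fun j => -d j), ?_⟩
  have h := (Tuple.monotone_sort fun j => -d j).strictMono_of_injective
    ((neg_injective.comp hd).comp (Tuple.sort _).injective)
  exact fun a b hab => neg_lt_neg_iff.1 (h hab)

lemma sqrt_le_norm_mul_norm_pinv {ι : Type*} [Fintype ι] {E : Matrix ι (Fin k) ℝ}
    (hE : IsUnit (Eᵀ * E).det) : √k ≤ ‖E‖ * ‖pinv E‖ := by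
  have h1 : ‖(1 : Matrix (Fin k) (Fin k) ℝ)‖ = √k := by
    rw [← Real.sqrt_sq (norm_nonneg _), norm_sq_eq_trace]
    simp
  rw [← h1, ← pinv_mul_self hE, mul_comm]
  exact Matrix.frobenius_norm_mul _ _

end Moments

/-! ### The reconstruction error -/

/-- Constant of the alignment error of `E` with one row removed, for `a = ‖Eᵢ‖`, `b = ‖Eᵢ⋆‖`. -/
def alignConst (a b : ℝ) : ℝ := 5 * b + 6 * a * b ^ 2

/-- Constant of the error of the core slice `Hᵢ`, for `a = ‖Eᵢ‖`, `b = ‖Eᵢ⋆‖`, `t = ‖M₃,ᵢ‖`. -/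
def sliceConst (a b t : ℝ) : ℝ := 4 * b ^ 2 + 6 * b ^ 3 * t * alignConst a b

/-- Constant of the error of the singular vectors of `H_r`. -/
noncomputable def vectorConst {n k : ℕ} (M : Matrix (Fin n) (Fin k) ℝ) (r : Fin n) : ℝ :=
  4 * (2 * ‖Matrix.diagonal (M r)‖ + 1) / rowGap M r ^ 2

lemma alignConst_nonneg {a b : ℝ} (ha : 0 ≤ a) (hb : 0 ≤ b) : 0 ≤ alignConst a b := by
  unfold alignConst; positivity

lemma sliceConst_nonneg {a b t : ℝ} (ha : 0 ≤ a) (hb : 0 ≤ b) (ht : 0 ≤ t) :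
    0 ≤ sliceConst a b t := by
  have := alignConst_nonneg ha hb
  unfold sliceConst; positivity

section Error

variable {n k : ℕ} {M : Matrix (Fin n) (Fin k) ℝ} {ω : Fin k → ℝ}
  {M2 : Matrix (Fin n) (Fin n) ℝ} {M3 : Fin n → Fin n → Fin n → ℝ} {ε : ℝ}

/-- After one orthogonal change of coordinates, all core slices of a run are close to the diagonal
matrices of the rows of `M`. -/
lemma Run.exists_orthogonal_coreSlice {hkn : k < n} {r : Fin n} (R : Run hkn r M2 M3)
    (hk : 0 < k) (hω : ∀ j, 0 ≤ ω j)
    (hrank : ∀ i, (secondMoment (removeRow M i) ω).rank = k)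
    (hM2 : ‖M2 - secondMoment M ω‖ ≤ ε) (hM3 : tensorNorm (M3 - thirdMoment M ω) ≤ ε)
    (hsmall : ∀ i, 6 * ‖pinv (removeRow (momentFactor M ω) i)‖ ^ 2 * ε < 1)
    (halign : ∀ i, ‖pinv (removeRow (momentFactor M ω) i)‖ *
      (alignConst ‖removeRow (momentFactor M ω) i‖ ‖pinv (removeRow (momentFactor M ω) i)‖ * ε)
        ≤ 1 / 2) :
    ∃ P : Matrix (Fin k) (Fin k) ℝ, P * Pᵀ = 1 ∧ ∀ i,
      IsUnit ((removeRow (R.E * P) i)ᵀ * removeRow (R.E * P) i).det ∧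
      ‖coreSlice (R.E * P) M3 i - Matrix.diagonal (M i)‖ ≤
        sliceConst ‖removeRow (momentFactor M ω) i‖ ‖pinv (removeRow (momentFactor M ω) i)‖
          ‖slice (thirdMoment M ω) i‖ * ε := by
  set F := momentFactor M ω with hF
  have hunit : ∀ i, IsUnit ((removeRow F i)ᵀ * removeRow F i).det := fun i =>
    isUnit_of_rank M hω (hrank i)
  rw [← momentFactor_mul_transpose M hω, ← hF] at hM2
  have hε0 : 0 ≤ ε := (norm_nonneg _).trans hM2
  have hbpos : ∀ i, 0 < ‖pinv (removeRow F i)‖ := fun i => by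
    have h1 := sqrt_le_norm_mul_norm_pinv (hunit i)
    have h2 : 0 < √(k : ℝ) := Real.sqrt_pos.2 (by exact_mod_cast hk)
    exact pos_of_mul_pos_right (h2.trans_le h1) (norm_nonneg _)
  have hsing : ∀ i, ∀ j : Fin k,
      (2 * ‖pinv (removeRow F i)‖ ^ 2)⁻¹ ≤ R.S (Fin.castLE hkn.le j) := fun i j => by
    have h1 := sub_le_leading_singular R.svd hkn.le hM2 (hbpos i) (fun y =>
      (norm_le_norm_pinv_mul (hunit i) y).trans (by
        gcongr
        rw [← removeRow_mul]
        exact norm_removeRow_le _ i)) j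
    have h2 := hsmall i
    have h3 : (0 : ℝ) < ‖pinv (removeRow F i)‖ ^ 2 := pow_pos (hbpos i) 2
    have h4 : ε ≤ (2 * ‖pinv (removeRow F i)‖ ^ 2)⁻¹ := by
      rw [← one_div, le_div_iff₀ (by positivity)]
      nlinarith
    have h5 : (‖pinv (removeRow F i)‖ ^ 2)⁻¹ = 2 * (2 * ‖pinv (removeRow F i)‖ ^ 2)⁻¹ := by
      field_simp
    linarith
  obtain ⟨Q, Q₀, hQ₀, hQ⟩ := exists_alignment R.svd hkn.le F hM2
    (σ₀ := (2 * ‖pinv (removeRow F r)‖ ^ 2)⁻¹) (by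
      have h3 : (0 : ℝ) < ‖pinv (removeRow F r)‖ ^ 2 := pow_pos (hbpos r) 2
      rw [← one_div, lt_div_iff₀ (by positivity)]
      have := hsmall r
      linarith) (hsing r)
  rw [← R.E_eq] at hQ
  refine ⟨Q₀ᵀ, by simpa using hQ₀, fun i => ?_⟩
  set a := ‖removeRow F i‖
  set b := ‖pinv (removeRow F i)‖
  have hb : 0 < b := hbpos i
  obtain ⟨h1, h2⟩ := hQ _ (by positivity) (hsing i)
  have hclose : ‖removeRow (R.E * Q₀ᵀ) i - removeRow F i‖ ≤ alignConst a b * ε := by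
    have e : removeRow (R.E * Q₀ᵀ) i - removeRow F i =
        (removeRow (R.E - F * Q) i + removeRow F i * (Q - Q₀)) * Q₀ᵀ := by
      have e1 : removeRow (R.E - F * Q) i = removeRow R.E i - removeRow F i * Q := rfl
      rw [e1, removeRow_mul, Matrix.mul_sub, Matrix.add_mul, Matrix.sub_mul, Matrix.sub_mul,
        Matrix.mul_assoc _ Q₀ Q₀ᵀ, mul_eq_one_comm.1 hQ₀, Matrix.mul_one]
      abel
    rw [e, norm_mul_of_mul_transpose (by simpa using hQ₀)]
    have hs : (√((2 * b ^ 2)⁻¹))⁻¹ ≤ 5 / 3 * b := by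
      rw [Real.sqrt_inv, inv_inv]
      exact Real.sqrt_le_iff.2 ⟨by positivity, by nlinarith [sq_nonneg b]⟩
    calc _ ≤ ‖R.E - F * Q‖ + a * ‖Q - Q₀‖ := (norm_add_le _ _).trans
          (add_le_add (norm_removeRow_le _ i) (Matrix.frobenius_norm_mul _ _))
      _ ≤ 3 * ε * (5 / 3 * b) + a * (3 * ε * (2 * b ^ 2)) := by
          refine add_le_add (h1.trans (by gcongr)) ?_
          rw [inv_inv] at h2
          gcongr
      _ = _ := by unfold alignConst; ring
  refine ⟨(isUnit_and_norm_pinv_le (hunit i) hclose (halign i)).1, ?_⟩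
  refine (norm_pinv_mul_mul_sub_le (hunit i) (slice_thirdMoment M hω i) hclose (halign i)
    ((norm_slice_sub_le _ _ i).trans hM3)).trans_eq ?_
  unfold sliceConst; ring

/-- The error of a run, for every `ε` below explicit thresholds. -/
lemma Run.norm_sub_output_le {hkn : k < n} {r : Fin n} (R : Run hkn r M2 M3)
    (hk : 0 < k) (hM : ∀ i j, 0 ≤ M i j) (hω : ∀ j, 0 ≤ ω j)
    (hrank : ∀ i, (secondMoment (removeRow M i) ω).rank = k)
    (hM2 : ‖M2 - secondMoment M ω‖ ≤ ε) (hM3 : tensorNorm (M3 - thirdMoment M ω) ≤ ε)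
    {π : Equiv.Perm (Fin k)} (hπ : StrictAnti fun j => M r (π j)) (hgap : 0 < rowGap M r)
    {a b p : Fin n → ℝ}
    (ha : ∀ i, a i = ‖removeRow (momentFactor M ω) i‖)
    (hb : ∀ i, b i = ‖pinv (removeRow (momentFactor M ω) i)‖)
    (hp : ∀ i, p i = sliceConst (a i) (b i) ‖slice (thirdMoment M ω) i‖)
    (hsmall : ∀ i, 6 * b i ^ 2 * ε < 1)
    (halign : ∀ i, b i * (alignConst (a i) (b i) * ε) ≤ 1 / 2)
    (hp1 : p r * ε ≤ 1) (hpg : 2 * (p r * ε) ≤ rowGap M r)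
    (hquad : ∀ i, √k * (k * (2 * ‖Matrix.diagonal (M i)‖ * (vectorConst M r * (p r * ε)) ^ 2))
      ≤ ε) (i : Fin n) :
    IsUnit ((removeRow R.E i)ᵀ * removeRow R.E i).det ∧
      ‖WithLp.toLp 2 (fun j => M i (π j) - R.output i j)‖ ≤ ((1 + a i * b i) * p i + 1) * ε := by
  have hunit : ∀ i, IsUnit ((removeRow (momentFactor M ω) i)ᵀ *
      removeRow (momentFactor M ω) i).det := fun i => isUnit_of_rank M hω (hrank i)
  have hε0 : 0 ≤ ε := (norm_nonneg _).trans hM2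
  have ha0 : 0 ≤ a i := by rw [ha]; positivity
  have hb0 : 0 ≤ b i := by rw [hb]; positivity
  have hp0 : 0 ≤ p i := by rw [hp]; exact sliceConst_nonneg ha0 hb0 (norm_nonneg _)
  obtain ⟨P, hP, hcore⟩ := R.exists_orthogonal_coreSlice hk hω hrank hM2 hM3
    (by simpa only [← hb] using hsmall) (by simpa only [← hb, ← ha] using halign)
  simp only [← ha, ← hb, ← hp] at hcore
  have hP' : Pᵀ * P = 1 := mul_eq_one_comm.1 hP
  set G := coreSlice (R.E * P) M3 with hG
  have hGE : ∀ i, G i = Pᵀ * coreSlice R.E M3 i * P := fun i =>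
    coreSlice_mul_orthogonal R.E hP' M3 i
  -- In the aligned coordinates the run uses the singular vectors `B` of `G r`.
  set B := Pᵀ * R.O with hB
  have hsvd : IsSVD (G r) B R.s (Pᵀ * R.W) := by
    have hPo : Pᵀ ∈ Matrix.orthogonalGroup (Fin k) ℝ :=
      (Matrix.mem_orthogonalGroup_iff _ _).2 (by simpa using hP')
    refine ⟨mul_mem hPo R.svd_r.left_orthogonal, mul_mem hPo R.svd_r.right_orthogonal,
      R.svd_r.nonneg, R.svd_r.antitone, ?_⟩
    rw [hGE, R.svd_r.eq, hB]
    simp only [Matrix.transpose_mul, Matrix.transpose_transpose, Matrix.mul_assoc]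
  refine ⟨?_, ?_⟩
  · have h := (hcore i).1
    rw [removeRow_mul, transpose_mul_self_mul, Matrix.det_mul, Matrix.det_mul] at h
    exact isUnit_of_mul_isUnit_right (isUnit_of_mul_isUnit_left h)
  by_cases hi : i = r
  · subst hi
    have hw : ‖WithLp.toLp 2 (fun j => M i (π j) - R.output i j)‖ ≤ √k * (p i * ε) := by
      refine norm_toLp_le (by positivity) fun j => ?_
      have := ((isSVD_diagonal (hM i) hπ.antitone).abs_singular_sub_le hsvd j).trans (hcore i).2
      rw [abs_sub_comm] at this
      simpa [Run.output] using this
    have hk' : √(k : ℝ) ≤ a i * b i := by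
      rw [ha, hb]; exact sqrt_le_norm_mul_norm_pinv (hunit i)
    have hpε : 0 ≤ p i * ε := by positivity
    nlinarith [mul_le_mul_of_nonneg_right hk' hpε]
  · have hout : ∀ j, R.output i j = (Bᵀ * G i * B) j j := fun j => by
      have : R.Oᵀ * coreSlice R.E M3 i * R.O = Bᵀ * G i * B := by
        rw [hGE, hB]
        simp only [Matrix.transpose_mul, Matrix.transpose_transpose, Matrix.mul_assoc]
        rw [← Matrix.mul_assoc P Pᵀ R.O, hP, Matrix.one_mul, ← Matrix.mul_assoc P Pᵀ, hP,
          Matrix.one_mul]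
      rw [← this]; simp [Run.output, hi]
    have e : WithLp.toLp 2 (fun j => M i (π j) - R.output i j) =
        WithLp.toLp 2 (fun j => M i (π j) - (Bᵀ * Matrix.diagonal (M i) * B) j j) -
          WithLp.toLp 2 (fun j => (Bᵀ * (G i - Matrix.diagonal (M i)) * B) j j) := by
      ext j
      simp only [hout, WithLp.ofLp_sub, Pi.sub_apply, Matrix.mul_sub, Matrix.sub_mul,
        Matrix.sub_apply]
      ring
    have n1 : ‖WithLp.toLp 2 (fun j => M i (π j) - (Bᵀ * Matrix.diagonal (M i) * B) j j)‖ ≤ ε :=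
      (norm_diag_conj_sub_le hsvd.left_tr_mul fun j l hl =>
        abs_left_singular_le hsvd (hM r) hπ.antitone hgap (fun _ _ h => rowGap_le M r h)
          (hcore r).2 hp1 hpg hl).trans (hquad i)
    have n2 : ‖WithLp.toLp 2 (fun j => (Bᵀ * (G i - Matrix.diagonal (M i)) * B) j j)‖ ≤
        p i * ε := by
      refine (norm_toLp_diag_le _).trans ?_
      rw [norm_mul_of_mul_transpose hsvd.left_mul_tr,
        norm_mul_of_transpose_mul (by simpa using hsvd.left_mul_tr)]
      exact (hcore i).2
    rw [e]
    refine (norm_sub_le _ _).trans ?_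
    have : 0 ≤ a i * b i * p i * ε := by positivity
    linarith

end Error

/-- The coefficient of `ε` in the error of row `i`, as a polynomial in `‖Eᵢ‖`, `‖Eᵢ⋆‖`, `‖O‖` and
`‖M₃,ᵢ‖`. The summand `1` absorbs the quadratic error of the singular vectors, and the factor
`1 + ‖Eᵢ‖ ‖Eᵢ⋆‖` bounds `√k`, which enters for `i = r`. -/
noncomputable def errorPoly : MvPolynomial (Fin 4) ℝ :=
  let a := MvPolynomial.X 0
  let b := MvPolynomial.X 1
  let t := MvPolynomial.X 3
  (1 + a * b) * (4 * b ^ 2 + 6 * b ^ 3 * t * (5 * b + 6 * a * b ^ 2)) + 1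

/-- Finitely many linear upper bounds on `ε` have a common positive threshold. -/
lemma exists_threshold {ι : Type*} [Finite ι] (f : ι → ℝ) :
    ∃ γ : ℝ, 0 < γ ∧ ∀ ε, 0 < ε → ε < γ → ∀ i, f i * ε < 1 := by
  obtain ⟨c, hc⟩ := (Set.finite_range f).bddAbove
  have hc' : 0 < max c 1 := lt_max_of_lt_right one_pos
  refine ⟨(max c 1)⁻¹, by positivity, fun ε h0 h1 i => ?_⟩
  calc f i * ε ≤ max c 1 * ε := by
        gcongr
        exact (hc ⟨i, rfl⟩).trans (le_max_left _ _)
    _ < max c 1 * (max c 1)⁻¹ := by gcongr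
    _ = 1 := mul_inv_cancel₀ hc'.ne'

end SVTD

theorem theorem5p1 :
    ∃ (C₁ C₂ C₃ : MvPolynomial (Fin 4) ℝ) (C₄ : MvPolynomial (Fin 6) ℝ),
      ∀ (n k : ℕ) (_ : 2 ≤ k) (hkn : k < n)
        (M : Matrix (Fin n) (Fin k) ℝ) (ω : Fin k → ℝ),
        (∀ i j, 0 ≤ M i j) → (∀ j, 0 ≤ ω j) →
        (∀ i, (SVTD.secondMoment (SVTD.removeRow M i) ω).rank = k) →
        0 < SVTD.singularGap k (SVTD.secondMoment M ω) →
        ∃ γ : ℝ, 0 < γ ∧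
          ∀ r : Fin n, 0 < SVTD.rowGap M r →
            ∃ π : Equiv.Perm (Fin k), StrictAnti (fun j => M r (π j)) ∧
              -- the matrices `E` and `O` of the unperturbed algorithm
              ∀ (E : Matrix (Fin n) (Fin k) ℝ) (O W : Matrix (Fin k) (Fin k) ℝ) (s : Fin k → ℝ),
                E * Eᵀ = SVTD.secondMoment M ω →
                SVTD.IsSVD (SVTD.coreSlice E (SVTD.thirdMoment M ω) r) O s W →
                ∀ (ε : ℝ) (M2 : Matrix (Fin n) (Fin n) ℝ) (M3 : Fin n → Fin n → Fin n → ℝ),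
                  ε < γ →
                  ‖M2 - SVTD.secondMoment M ω‖ < ε →
                  SVTD.tensorNorm (M3 - SVTD.thirdMoment M ω) < ε →
                  ∀ R : SVTD.Run hkn r M2 M3, ∀ i : Fin n,
                    IsUnit ((SVTD.removeRow R.E i)ᵀ * SVTD.removeRow R.E i).det ∧
                    ‖WithLp.toLp 2 (fun j => M i (π j) - R.output i j)‖ ≤
                      let E_i := SVTD.removeRow E i
                      let M3_i := SVTD.slice (SVTD.thirdMoment M ω) i
                      let α_r := SVTD.rowGap M r
                      let α_M2 := SVTD.singularGap k (SVTD.secondMoment M ω)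
                      let x : Fin 4 → ℝ := ![‖E_i‖, ‖SVTD.pinv E_i‖, ‖O‖, ‖M3_i‖]
                      let y : Fin 6 → ℝ :=
                        ![‖E_i‖, ‖SVTD.pinv E_i‖, ‖O‖, ‖M3_i‖, 1 / α_r, 1 / α_M2]
                      C₁.eval x * ε + √k * (ε / α_r) * (C₂.eval x + C₃.eval x / α_M2)
                        + √k * C₄.eval y * ε ^ 2 := by
  refine ⟨SVTD.errorPoly, 0, 0, 0, fun n k hk hkn M ω hM hω hrank _ => ?_⟩
  set F := SVTD.momentFactor M ω with hF
  obtain ⟨a, ha⟩ : ∃ a : Fin n → ℝ, ∀ i, a i = ‖SVTD.removeRow F i‖ := ⟨_, fun _ => rfl⟩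
  obtain ⟨b, hb⟩ : ∃ b : Fin n → ℝ, ∀ i, b i = ‖SVTD.pinv (SVTD.removeRow F i)‖ :=
    ⟨_, fun _ => rfl⟩
  obtain ⟨p, hp⟩ : ∃ p : Fin n → ℝ, ∀ i, p i =
      SVTD.sliceConst (a i) (b i) ‖SVTD.slice (SVTD.thirdMoment M ω) i‖ := ⟨_, fun _ => rfl⟩
  obtain ⟨γ₁, hγ₁, h₁⟩ := SVTD.exists_threshold fun i => 6 * b i ^ 2
  obtain ⟨γ₂, hγ₂, h₂⟩ := SVTD.exists_threshold fun i =>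
    2 * (b i * SVTD.alignConst (a i) (b i))
  obtain ⟨γ₃, hγ₃, h₃⟩ := SVTD.exists_threshold p
  obtain ⟨γ₄, hγ₄, h₄⟩ := SVTD.exists_threshold fun r => 2 * p r / SVTD.rowGap M r
  obtain ⟨γ₅, hγ₅, h₅⟩ := SVTD.exists_threshold fun q : Fin n × Fin n =>
    √k * (k * (2 * ‖Matrix.diagonal (M q.2)‖ * (SVTD.vectorConst M q.1 * p q.1) ^ 2))
  refine ⟨min γ₁ (min γ₂ (min γ₃ (min γ₄ γ₅))), by positivity, fun r hr => ?_⟩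
  have hinj : Function.Injective (M r) := fun l l' h => by
    by_contra hne
    have := SVTD.rowGap_le M r hne
    rw [h, sub_self, abs_zero] at this
    linarith
  obtain ⟨π, hπ⟩ := SVTD.exists_perm_strictAnti hinj
  refine ⟨π, hπ, fun E O W s hE _ ε M2 M3 hε hM2 hM3 R i => ?_⟩
  have hε0 : 0 < ε := (norm_nonneg _).trans_lt hM2
  simp only [lt_min_iff] at hε
  obtain ⟨hε₁, hε₂, hε₃, hε₄, hε₅⟩ := hε
  have hmain := R.norm_sub_output_le (by omega) hM hω hrank hM2.le hM3.le hπ hr ha hb hp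
    (h₁ ε hε0 hε₁) (fun i => by have := h₂ ε hε0 hε₂ i; linarith) (h₃ ε hε0 hε₃ r).le
    (by
      have := (h₄ ε hε0 hε₄ r).le
      rw [div_mul_eq_mul_div, div_le_one hr] at this
      linarith)
    (fun i => by
      have := mul_le_mul_of_nonneg_right (h₅ ε hε0 hε₅ (r, i)).le hε0.le
      rw [one_mul] at this
      refine le_trans (le_of_eq ?_) this
      ring) i
  refine ⟨hmain.1, hmain.2.trans (le_of_eq ?_)⟩
  -- The norms in the bound do not depend on the choice of the factor `E`.
  obtain ⟨hnE, hnP⟩ := SVTD.norm_factor_eq (SVTD.isUnit_of_rank M hω (hrank i))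
    (SVTD.removeRow_mul_transpose (hE.trans (SVTD.momentFactor_mul_transpose M hω).symm) i)
  rw [← hF, ← ha] at hnE
  rw [← hF, ← hb] at hnP
  simp [SVTD.errorPoly, hnE, hnP, hp, SVTD.sliceConst, SVTD.alignConst]
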